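/- Let $S$ be a triangulation of the 3-sphere, i.e. a finite, pure, 3-dimensional abstract simplicial complex whose geometric realization is homeomorphic to $S^3$. Let $\Gamma(S)$ be its dual graph: its nodes are the tetrahedra of $S$, and two distinct tetrahedra are joined by an arc if and only if they share a triangle. For a spanning tree $T$ of $\Gamma(S)$, let $S_T$ be the 2-dimensional complex obtained by collapsing $S$ along $T$, i.e. by removing from $S$ all tetrahedra and all triangles $\Delta\cap\Delta'$ corresponding to arcs $\{\Delta,\Delta'\}$ of $T$. An edge $e$ of $S$ is called free in $S_T$ if it is contained in exactly one triangle of $S_T$. Let $e$ be an edge of $S$ of degree $k$, i.e. contained in exactly $k$ tetrahedra of $S$, and let $$p=\frac{\#\{T : T \text{ is a spanning tree of } \Gamma(S) \text{ and } e \text{ is free in } S_T\}}{\#\{T : T \text{ is a spanning tree of } \Gamma(S)\}}.$$ Then $$p\;\ge\;\frac{4}{7}\cdot\left(\frac{4}{13}\right)^{k-2}.$$ -/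

import Mathlib

namespace PreAbstractSimplicialComplex

/-- A facet is a face which is maximal with respect to inclusion. -/
def IsFacet {V : Type*} (K : PreAbstractSimplicialComplex V) (s : Finset V) : Prop :=
  Maximal (fun t => t ∈ K.faces) s

/-- A complex is pure of dimension `d` if all its facets have exactly `d + 1` vertices. -/
def IsPureOfDim {V : Type*} (K : PreAbstractSimplicialComplex V) (d : ℕ) : Prop :=
  ∀ s, K.IsFacet s → s.card = d + 1

/-- The geometric realization of a complex on a finite vertex set, in barycentric coordinates:
the points of the standard simplex whose support is a face, topologized as a subspace of
`V → ℝ`. -/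
def realization {V : Type*} [Fintype V] (K : PreAbstractSimplicialComplex V) : Set (V → ℝ) :=
  {x | x ∈ stdSimplex ℝ V ∧ ∃ s ∈ K.faces, ∀ v, x v ≠ 0 ↔ v ∈ s}

/-- A triangulation of the `d`-sphere: a pure `d`-dimensional simplicial complex whose
underlying topological space is homeomorphic to the unit sphere of `ℝ ^ (d + 1)`. -/
structure IsSphereTriangulation {V : Type*} [Fintype V]
    (K : PreAbstractSimplicialComplex V) (d : ℕ) : Prop where
  pure : K.IsPureOfDim d
  homeo : Nonempty (K.realization ≃ₜ Metric.sphere (0 : EuclideanSpace ℝ (Fin (d + 1))) 1)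

/-- The type of tetrahedra (faces with four vertices). In a pure `3`-dimensional complex these are
exactly the facets. -/
abbrev Tetrahedron {V : Type*} (K : PreAbstractSimplicialComplex V) : Type _ :=
  {s : Finset V // s ∈ K.faces ∧ s.card = 4}

/-- The dual graph (face pairing graph): its nodes are the tetrahedra, and two distinct tetrahedra
are joined by an arc if they have a common triangle. -/
def dualGraph {V : Type*} [DecidableEq V] (K : PreAbstractSimplicialComplex V) :
    SimpleGraph K.Tetrahedron where
  Adj D D' := D ≠ D' ∧ (D.1 ∩ D'.1).card = 3
  symm := ⟨fun D D' h => ⟨h.1.symm, by rw [Finset.inter_comm]; exact h.2⟩⟩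
  loopless := ⟨fun _ h => h.1 rfl⟩

/-- The spanning trees of a graph, as subgraphs on the same set of nodes. -/
def _root_.SimpleGraph.spanningTrees {N : Type*} (G : SimpleGraph N) : Set (SimpleGraph N) :=
  {T | T ≤ G ∧ T.IsTree}

/-- The degree of an edge in a `3`-dimensional complex: the number of tetrahedra containing it. -/
noncomputable def edgeDegree {V : Type*} (K : PreAbstractSimplicialComplex V)
    (e : Finset V) : ℕ :=
  {s : Finset V | s ∈ K.faces ∧ s.card = 4 ∧ e ⊆ s}.ncard

/-- The complex obtained from a `3`-dimensional complex by collapsing along a subgraph `T` of the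
dual graph. For a spanning tree `T` of the dual graph of a triangulated `3`-sphere, one removes the
tetrahedron at a root node, and then collapses every other tetrahedron through the triangle
corresponding to the arc of `T` leading to it; thus all tetrahedra disappear together with
all triangles `D ∩ D'` which correspond to arcs of `T`, and all other faces remain. -/
def collapseAlong {V : Type*} [DecidableEq V] (K : PreAbstractSimplicialComplex V)
    (T : SimpleGraph K.Tetrahedron) : PreAbstractSimplicialComplex V where
  faces := {s | s ∈ K.faces ∧ s.card ≤ 3 ∧
    ¬ ∃ D D' : K.Tetrahedron, T.Adj D D' ∧ s.card = 3 ∧ s = D.1 ∩ D'.1}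
  isRelLowerSet_faces := by
    rintro s ⟨hs, hc, hT⟩
    refine ⟨(K.isRelLowerSet_faces hs).1, fun t hts ht => ?_⟩
    have hts' : t ⊆ s := hts
    refine ⟨(K.isRelLowerSet_faces hs).2 hts ht,
      (Finset.card_le_card hts').trans hc, ?_⟩
    rintro ⟨D, D', hD, h3, hinter⟩
    have hst : t = s := Finset.eq_of_subset_of_card_le hts' (by omega)
    subst hst
    exact hT ⟨D, D', hD, h3, hinter⟩

/-- An edge is free in a `2`-dimensional complex if it is contained in exactly one triangle. -/
def IsFreeEdge {V : Type*} (K : PreAbstractSimplicialComplex V) (e : Finset V) : Prop :=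
  e ∈ K.faces ∧ e.card = 2 ∧ {t : Finset V | t ∈ K.faces ∧ t.card = 3 ∧ e ⊆ t}.ncard = 1

/-- The proportion of spanning trees `T` of the dual graph for which `e` is free in the complex
collapsed along `T`. -/
noncomputable def freeProportion {V : Type*} [DecidableEq V]
    (K : PreAbstractSimplicialComplex V) (e : Finset V) : ℝ :=
  ({T | T ∈ K.dualGraph.spanningTrees ∧ (K.collapseAlong T).IsFreeEdge e}.ncard : ℝ) /
    (K.dualGraph.spanningTrees.ncard : ℝ)

end PreAbstractSimplicialComplex

/-! The tetrahedra around `e` form a cycle of length `k` in the dual graph, whose arcs correspond to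
the triangles containing `e`. Hence `e` is free in the collapsed complex exactly when the tree
contains all but one of these arcs. The cycle is chordless, and nodes of the dual graph have degree
at most four, since a triangle lies in exactly two tetrahedra.

The bound needs only the trees that contain the first `k - 2` arcs of the cycle and one of the two
arcs at the last node. They are reached one arc at a time. Suppose a tree contains the path `D 0,
..., D j` but no arc from `v = D (j + 1)` to it. Adding the arc `uv` with `u = D j` closes a cycle
`v, w, x, ..., u`, and deleting `vw` or `wx` gives two trees containing `uv`. Double counting both
exchanges (`card_trees_exchange`) bounds the bad trees by `3 |W| / 4` times the good ones, where `W`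
is the set of neighbours of `v` off the path. Usually `|W| ≤ 3`, so a proportion `1 / (1 + 9/4) =
4/13` survives. At the last node `|W| ≤ 2` and there are two disjoint ways to succeed, which gives
`1 / (1 + 3/4) = 4/7` (`proportion_trees_chordless_cycle`).

The rest is topology: the link of an edge is a single cycle (`exists_link_cycle`), a triangle lies
in exactly two tetrahedra (`exists_two_facets`), and the dual graph is connected
(`connected_dualGraph`). The first two follow from invariance of domain: a family of simplices
around a face that already forms an open ball must be the whole star of that face. Invariance of
domain is itself derived from the absence of a smooth retraction onto a sphere. -/

section

open Set Metric MeasureTheory Filter Topology Module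
open scoped ContDiff NNReal

/-! ### No smooth retraction of a ball onto its boundary -/

namespace InvarianceOfDomain

section Degree

variable {E : Type*} [NormedAddCommGroup E] [InnerProductSpace ℝ E]

/-- A map which is Lipschitz on a ball and vanishes on its boundary extends by zero
to a Lipschitz map. -/
theorem lipschitzWith_indicator_closedBall {w : E → E} {R : ℝ} {K : ℝ≥0}
    (hw : LipschitzOnWith K w (closedBall 0 R)) (h0 : ∀ x, ‖x‖ = R → w x = 0) :
    LipschitzWith K ((closedBall (0 : E) R).indicator w) := by
  have key : ∀ x y : E, ‖x‖ ≤ R → R < ‖y‖ → dist (w x) 0 ≤ K * dist x y := by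
    intro x y hx hy
    obtain ⟨s, hs, hs'⟩ : R ∈ (fun s : ℝ => ‖AffineMap.lineMap x y s‖) '' Icc (0 : ℝ) 1 := by
      apply intermediate_value_Icc zero_le_one
      · fun_prop
      · simp [hx, hy.le]
    simp only at hs'
    have hz := hw.dist_le_mul x (by simpa using hx) (AffineMap.lineMap x y s) (by simp [hs'])
    rw [h0 _ hs'] at hz
    refine hz.trans ?_
    gcongr
    rw [dist_left_lineMap]
    rw [Real.norm_of_nonneg hs.1]
    exact mul_le_of_le_one_left dist_nonneg hs.2
  refine LipschitzWith.of_dist_le_mul fun x y => ?_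
  by_cases hx : ‖x‖ ≤ R <;> by_cases hy : ‖y‖ ≤ R
  · rw [indicator_of_mem (by simpa using hx), indicator_of_mem (by simpa using hy)]
    exact hw.dist_le_mul x (by simpa using hx) y (by simpa using hy)
  · rw [indicator_of_mem (by simpa using hx), indicator_of_notMem (by simpa using hy)]
    exact key x y hx (not_le.1 hy)
  · rw [indicator_of_notMem (by simpa using hx), indicator_of_mem (by simpa using hy), dist_comm,
      dist_comm x]
    exact key y x hy (not_le.1 hx)
  · rw [indicator_of_notMem (by simpa using hx), indicator_of_notMem (by simpa using hy)]
    simp; positivity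

variable [FiniteDimensional ℝ E]

theorem exists_polynomial_det_add_smul (A B : E →L[ℝ] E) :
    ∃ p : Polynomial ℝ, p.natDegree ≤ finrank ℝ E ∧ ∀ t : ℝ, p.eval t = (A + t • B).det := by
  classical
  let b := finBasis ℝ E
  let MA := LinearMap.toMatrix b b (A : E →ₗ[ℝ] E)
  let MB := LinearMap.toMatrix b b (B : E →ₗ[ℝ] E)
  refine ⟨((Polynomial.X : Polynomial ℝ) • MB.map Polynomial.C + MA.map Polynomial.C).det, ?_,
    fun t => ?_⟩
  · simpa using Polynomial.natDegree_det_X_add_C_le MB MA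
  · rw [← Polynomial.coe_evalRingHom, RingHom.map_det, ContinuousLinearMap.det,
      ← LinearMap.det_toMatrix b]
    congr 1
    ext i j
    simp [MA, MB, LinearMap.toMatrix_apply]
    ring

/-- Lagrange interpolation at nodes close to `0`. It carries an identity between polynomials in `t`,
known only for small `t`, over to `t = 1`. -/
theorem exists_interpolation_nodes (n : ℕ) {ε : ℝ} (hε : 0 < ε) :
    ∃ (t c : ℕ → ℝ), (∀ j, t j ∈ Ioo 0 ε) ∧ ∑ j ∈ Finset.range (n + 1), c j = 1 ∧
      ∀ p : Polynomial ℝ, p.natDegree ≤ n →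
        p.eval 1 = ∑ j ∈ Finset.range (n + 1), p.eval (t j) * c j := by
  let t : ℕ → ℝ := fun j => ε / (j + 2)
  have ht : InjOn t (Finset.range (n + 1)) := by
    intro i _ j _ h
    have : (i : ℝ) + 2 = j + 2 := by
      simp only [t] at h
      field_simp at h
      linarith
    exact_mod_cast (add_right_cancel this)
  refine ⟨t, fun j => (Lagrange.basis (Finset.range (n + 1)) t j).eval 1, fun j => ⟨by positivity, ?_⟩,
    ?_, fun p hp => ?_⟩
  · exact div_lt_self hε (by linarith [Nat.cast_nonneg (α := ℝ) j])
  · rw [← Polynomial.eval_finsetSum, Lagrange.sum_basis ht (by simp)]; simp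
  · have hd : p.degree < (Finset.range (n + 1)).card := by
      rw [Finset.card_range]
      exact lt_of_le_of_lt Polynomial.degree_le_natDegree (by exact_mod_cast Nat.lt_succ_of_le hp)
    conv_lhs => rw [Lagrange.eq_interpolate ht hd, Lagrange.interpolate_apply,
      Polynomial.eval_finsetSum]
    simp

/-- Differentiating the constant `‖r‖ ^ 2` shows that the range of `r'` is orthogonal to `r x`,
which is nonzero. So `r'` is not surjective. -/
theorem det_fderiv_eq_zero_of_norm_const {r : E → E} {r' : E →L[ℝ] E} {x : E} {R : ℝ}
    (hR : 0 < R) (hr : ∀ y, ‖r y‖ = R) (h : HasFDerivAt r r' x) : r'.det = 0 := by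
  by_contra hdet
  obtain ⟨v, hv⟩ := (r'.toContinuousLinearEquivOfDetNeZero hdet).surjective (r x)
  have hv' : r' v = r x := hv
  have h1 := h.norm_sq
  have h2 : HasFDerivAt (fun y => ‖r y‖ ^ 2) (0 : E →L[ℝ] ℝ) x := by
    simp only [hr]
    exact hasFDerivAt_const _ _
  have h3 := congrArg (fun L => L v) (h1.unique h2)
  simp [hv'] at h3
  have := hr x
  rw [h3] at this
  simp at this
  linarith

/-- The perturbation is `1/2`-Lipschitz, so the map is a bijection of the whole space. It fixes
every point outside the ball, hence permutes the ball. -/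
theorem image_closedBall_of_perturbation [Nontrivial E] {w : E → E} {R : ℝ} {K : ℝ≥0}
    (hw : LipschitzWith K w) (h0 : ∀ x ∉ closedBall (0 : E) R, w x = 0)
    {t : ℝ} (ht0 : 0 ≤ t) (ht : t * K ≤ 1 / 2) :
    Function.Injective (fun x => x + t • w x) ∧
      (fun x => x + t • w x) '' closedBall 0 R = closedBall 0 R := by
  have happ : ApproximatesLinearOn (fun x => x + t • w x)
      ((ContinuousLinearEquiv.refl ℝ E : E ≃L[ℝ] E) : E →L[ℝ] E) univ (1 / 2) := by
    intro x _ y _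
    have h1 := hw.dist_le_mul x y
    rw [dist_eq_norm, dist_eq_norm] at h1
    have : x + t • w x - (y + t • w y) - (x - y) = t • (w x - w y) := by
      rw [smul_sub]; abel
    simp only [ContinuousLinearEquiv.coe_refl, ContinuousLinearMap.coe_id', id_eq, this, norm_smul,
      Real.norm_of_nonneg ht0]
    calc t * ‖w x - w y‖ ≤ t * (K * ‖x - y‖) := by gcongr
      _ = (t * K) * ‖x - y‖ := by ring
      _ ≤ (1 / 2) * ‖x - y‖ := by gcongr
      _ = _ := by simp
  have hc : Subsingleton E ∨ (1 / 2 : ℝ≥0) <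
      ‖((ContinuousLinearEquiv.refl ℝ E : E ≃L[ℝ] E).symm : E →L[ℝ] E)‖₊⁻¹ := by
    right
    have : ‖((ContinuousLinearEquiv.refl ℝ E : E ≃L[ℝ] E).symm : E →L[ℝ] E)‖₊ = 1 := by
      apply NNReal.eq
      simp
    rw [this, inv_one]
    exact NNReal.half_lt_self one_ne_zero
  have hinj : Function.Injective (fun x => x + t • w x) :=
    injOn_univ.1 (happ.injOn hc)
  have hsurj : Function.Surjective (fun x => x + t • w x) := happ.surjective hc
  refine ⟨hinj, ?_⟩
  have hcompl : (fun x => x + t • w x) '' (closedBall 0 R)ᶜ = (closedBall 0 R)ᶜ := by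
    have : EqOn (fun x => x + t • w x) id (closedBall 0 R)ᶜ := fun x hx => by simp [h0 x hx]
    rw [this.image_eq, image_id]
  rw [← compl_inj_iff, ← image_compl_eq ⟨hinj, hsurj⟩, hcompl]

/-- Deform the identity to `r` by `x + t (r x - x)`. The integral over the ball of the Jacobian
determinant is a polynomial in `t`. For small `t` it equals the volume of the ball, hence also at `t
= 1`, where the determinant vanishes because `r` has constant norm. -/
theorem no_smooth_retraction [Nontrivial E] {r : E → E} {R : ℝ} (hR : 0 < R)
    (hr : ContDiff ℝ 1 r) (hnorm : ∀ x, ‖r x‖ = R) (hid : ∀ x, ‖x‖ = R → r x = x) : False := by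
  borelize E
  let B : Set E := closedBall 0 R
  have hBc : IsCompact B := isCompact_closedBall 0 R
  let u : E → E := fun x => r x - x
  have hu : ContDiff ℝ 1 u := hr.sub contDiff_id
  obtain ⟨K, hK⟩ := hu.contDiffOn.exists_lipschitzOnWith one_ne_zero
    (convex_closedBall (0 : E) R) hBc
  -- The displacement is cut off outside the ball; it vanishes on the boundary sphere, so it stays
  -- Lipschitz.
  let w := B.indicator u
  have hw : LipschitzWith K w := lipschitzWith_indicator_closedBall hK
    (fun x hx => by simp [u, hid x hx])
  have hw0 : ∀ x ∉ B, w x = 0 := fun x hx => indicator_of_notMem hx _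
  let D : ℝ → E → ℝ := fun t x => (ContinuousLinearMap.id ℝ E + t • fderiv ℝ u x).det
  have hfu : Continuous (fderiv ℝ u) := hu.continuous_fderiv one_ne_zero
  have hD : Continuous (fun z : ℝ × E => D z.1 z.2) :=
    ContinuousLinearMap.continuous_det.comp (by fun_prop)
  have hDpos : ∀ᶠ t in 𝓝 (0 : ℝ), ∀ x ∈ B, 0 < D t x := by
    refine hBc.eventually_forall_of_forall_eventually fun x _ => ?_
    refine hD.continuousAt.eventually_mem (s := Ioi 0) (IsOpen.mem_nhds isOpen_Ioi ?_)
    simp [D, ContinuousLinearMap.det]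
  obtain ⟨ε₁, hε₁, hpos⟩ := Metric.eventually_nhds_iff.1 hDpos
  let ε := min ε₁ (1 / (2 * (K + 1)))
  have hε : 0 < ε := lt_min hε₁ (by positivity)
  have hsmall : ∀ t ∈ Ioo 0 ε, ∫ x in B, D t x = volume.real B := by
    intro t ht
    have htK : t * K ≤ 1 / 2 := by
      have h1 : t ≤ 1 / (2 * (K + 1)) := ht.2.le.trans (min_le_right _ _)
      rw [le_div_iff₀ (by positivity)] at h1
      nlinarith [ht.1]
    obtain ⟨hinj, himg⟩ := image_closedBall_of_perturbation hw hw0 ht.1.le htK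
    have hder : ∀ x ∈ B, HasFDerivWithinAt (fun x => x + t • w x)
        (ContinuousLinearMap.id ℝ E + t • fderiv ℝ u x) B x := by
      intro x hx
      have h1 : HasFDerivAt (fun x => x + t • u x)
          (ContinuousLinearMap.id ℝ E + t • fderiv ℝ u x) x :=
        (hasFDerivAt_id x).add
          (((hu.differentiable one_ne_zero) x).hasFDerivAt.const_smul t)
      refine h1.hasFDerivWithinAt.congr (fun y hy => ?_) ?_
      · simp [w, indicator_of_mem hy]
      · simp [w, indicator_of_mem hx]
    have := integral_image_eq_integral_abs_det_fderiv_smul volume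
      (measurableSet_closedBall (x := (0 : E)) (ε := R)) hder hinj.injOn (fun _ => (1 : ℝ))
    rw [himg] at this
    simp only [smul_eq_mul, mul_one, integral_const, MeasurableSet.univ, measureReal_restrict_apply,
      univ_inter] at this
    rw [this]
    refine setIntegral_congr_fun measurableSet_closedBall fun x hx => ?_
    refine (abs_of_pos (hpos ?_ x hx)).symm
    simp only [dist_zero_right, Real.norm_eq_abs, abs_of_pos ht.1]
    exact ht.2.trans_le (min_le_left _ _)
  obtain ⟨t, c, ht, hc, hint⟩ := exists_interpolation_nodes (finrank ℝ E) hε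
  have hone : ∀ x, D 1 x = ∑ j ∈ Finset.range (finrank ℝ E + 1), D (t j) x * c j := by
    intro x
    obtain ⟨p, hp, hpe⟩ := exists_polynomial_det_add_smul (ContinuousLinearMap.id ℝ E)
      (fderiv ℝ u x)
    have := hint p hp
    simpa only [hpe] using this
  have hzero : ∀ x, D 1 x = 0 := by
    intro x
    have hrx := ((hr.differentiable one_ne_zero) x).hasFDerivAt
    have : ContinuousLinearMap.id ℝ E + (1 : ℝ) • fderiv ℝ u x = fderiv ℝ r x := by
      have h1 : fderiv ℝ u x = fderiv ℝ r x - ContinuousLinearMap.id ℝ E :=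
        (hrx.sub (hasFDerivAt_id x)).fderiv
      rw [h1]; simp
    simp only [D, this]
    exact det_fderiv_eq_zero_of_norm_const hR hnorm hrx
  have hcontra : ∫ x in B, D 1 x = volume.real B := by
    simp_rw [hone]
    rw [integral_finsetSum]
    · simp_rw [integral_mul_const]
      rw [Finset.sum_congr rfl fun j _ => by rw [hsmall (t j) (ht j)], ← Finset.mul_sum, hc,
        mul_one]
    · intro j _
      refine Integrable.mul_const ?_ _
      have : Continuous (D (t j)) := hD.comp (continuous_const.prodMk continuous_id)
      exact this.continuousOn.integrableOn_compact hBc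
  simp only [hzero, integral_zero] at hcontra
  have : 0 < volume.real B := by
    rw [measureReal_def]
    exact ENNReal.toReal_pos (measure_closedBall_pos volume 0 hR).ne'
      (measure_closedBall_lt_top).ne
  linarith

end Degree
end InvarianceOfDomain

end

/-! ### Brouwer-type zero theorems and invariance of domain -/

section

open Set Metric MeasureTheory Filter Topology Module
open scoped ContDiff NNReal Manifold

namespace InvarianceOfDomain

section Brouwer

variable {E : Type*} [NormedAddCommGroup E] [InnerProductSpace ℝ E] [FiniteDimensional ℝ E]

theorem exists_contDiff_mem {F : Type*} [NormedAddCommGroup F] [NormedSpace ℝ F] (t : E → Set F)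
    (ht : ∀ x, Convex ℝ (t x)) (hloc : ∀ x, ∃ c : F, ∀ᶠ y in 𝓝 x, c ∈ t y) :
    ∃ g : E → F, ContDiff ℝ 1 g ∧ ∀ x, g x ∈ t x := by
  obtain ⟨g, hg⟩ := exists_contMDiffMap_forall_mem_convex_of_local_const (n := 1) 𝓘(ℝ, E) ht hloc
  exact ⟨g, g.contMDiff.contDiff, hg⟩

theorem exists_contDiff_approx (G : E → E) (hG : Continuous G) {δ : ℝ} (hδ : 0 < δ) :
    ∃ P : E → E, ContDiff ℝ 1 P ∧ ∀ x, ‖P x - G x‖ < δ := by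
  obtain ⟨P, hP, h⟩ := exists_contDiff_mem (fun x => ball (G x) δ) (fun x => convex_ball _ _)
    (fun x => ⟨G x, by
      filter_upwards [hG.continuousAt.eventually_mem (ball_mem_nhds (G x) hδ)] with y hy
      rwa [mem_ball_comm]⟩)
  exact ⟨P, hP, fun x => by simpa [dist_eq_norm] using h x⟩

/-- A continuous self-map which is the identity outside a ball has a zero. -/
theorem exists_zero_of_eq_id_outside [Nontrivial E] {H : E → E} (hH : Continuous H) {R : ℝ}
    (hR : 0 ≤ R) (hid : ∀ x, R < ‖x‖ → H x = x) : ∃ x, H x = 0 := by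
  by_contra! hne
  obtain ⟨δ, hδ, hmin⟩ : ∃ δ > 0, ∀ x ∈ closedBall (0 : E) (R + 1), δ ≤ ‖H x‖ := by
    obtain ⟨x₀, -, hx₀⟩ := (isCompact_closedBall (0 : E) (R + 1)).exists_isMinOn
      ⟨0, by simp; linarith⟩ (hH.norm.continuousOn)
    exact ⟨‖H x₀‖, norm_pos_iff.2 (hne x₀), fun x hx => hx₀ hx⟩
  -- A smooth approximation of the displacement `H x - x`, forced to vanish beyond radius `R + 1`.
  -- Both constraints are convex and have locally constant solutions.
  obtain ⟨g, hg, hgt⟩ := exists_contDiff_mem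
    (fun x => ball (H x - x) δ ∩ {v : E | R + 1 ≤ ‖x‖ → v = 0})
    (fun x => (convex_ball _ _).inter (by
      by_cases h : R + 1 ≤ ‖x‖
      · simp [h]
      · simp [h, convex_univ]))
    (fun x => by
      rcases lt_or_ge R ‖x‖ with hx | hx
      · refine ⟨0, ?_⟩
        filter_upwards [continuous_norm.continuousAt.eventually_mem (Ioi_mem_nhds hx)] with y hy
        simp [hid y hy, hδ]
      · refine ⟨H x - x, ?_⟩
        have h1 : ContinuousAt (fun y => H y - y) x := by fun_prop
        filter_upwards [continuous_norm.continuousAt.eventually_mem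
          (Iio_mem_nhds (show ‖x‖ < R + 1 by linarith)),
          h1.eventually_mem (ball_mem_nhds _ hδ)] with y hy hy'
        refine ⟨by rwa [mem_ball_comm], fun h => absurd hy (not_lt.2 h)⟩)
  let H' : E → E := fun x => x + g x
  have hH' : ContDiff ℝ 1 H' := contDiff_id.add hg
  have hne' : ∀ x, H' x ≠ 0 := by
    intro x hx
    obtain ⟨h1, h2⟩ := hgt x
    rcases lt_or_ge ‖x‖ (R + 1) with hlt | hge
    · have h3 := hmin x (by simpa using hlt.le)
      rw [mem_ball, dist_eq_norm] at h1
      have h4 : g x - (H x - x) = -H x := by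
        have : H' x = 0 := hx
        simp only [H'] at this
        rw [show g x - (H x - x) = (x + g x) - H x by abel, this, zero_sub]
      rw [h4, norm_neg] at h1
      linarith
    · have h3 : g x = 0 := h2 hge
      simp only [H', h3, add_zero] at hx
      rw [hx, norm_zero] at hge
      linarith
  -- On the sphere of radius `R + 2` the map `H'` is the identity, so its normalization would be a
  -- smooth retraction.
  refine no_smooth_retraction (R := R + 2) (r := fun x => ((R + 2) / ‖H' x‖) • H' x)
    (by linarith) ?_ ?_ ?_
  · refine ContDiff.smul (contDiff_const.div (hH'.norm ℝ hne') fun x => norm_ne_zero_iff.2 (hne' x))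
      hH'
  · intro x
    rw [norm_smul, norm_div, norm_norm, div_mul_cancel₀ _ (norm_ne_zero_iff.2 (hne' x)),
      Real.norm_of_nonneg (by linarith)]
  · intro x hx
    have h3 : g x = 0 := (hgt x).2 (by linarith)
    have h4 : H' x = x := by simp [H', h3]
    simp only [h4, hx]
    rw [div_self (by linarith), one_smul]

/-- Extend `q` through the radial projection `pr` and fade its displacement out between radii `1`
and `2`. A zero of the extension equals minus a displacement of norm at most one, so it already lies
in the unit ball. -/
theorem exists_zero_of_norm_sub_le_one [Nontrivial E] {q : E → E}
    (hq : ContinuousOn q (closedBall 0 1)) (h : ∀ x ∈ closedBall (0 : E) 1, ‖q x - x‖ ≤ 1) :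
    ∃ x ∈ closedBall (0 : E) 1, q x = 0 := by
  let pr : E → E := fun x => (max 1 ‖x‖)⁻¹ • x
  have hpr : Continuous pr :=
    ((continuous_const.max continuous_norm).inv₀ fun x => by positivity).smul continuous_id
  have hprm : ∀ x, pr x ∈ closedBall (0 : E) 1 := by
    intro x
    simp only [pr, mem_closedBall, dist_zero_right, norm_smul, norm_inv]
    rw [Real.norm_of_nonneg (by positivity), inv_mul_le_iff₀ (by positivity)]
    simp
  let H : E → E := fun x => x + max 0 (min 1 (2 - ‖x‖)) • (q (pr x) - pr x)
  have hH : Continuous H := by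
    have : Continuous fun x => q (pr x) := hq.comp_continuous hpr hprm
    exact continuous_id.add ((continuous_const.max
      (continuous_const.min (continuous_const.sub continuous_norm))).smul (this.sub hpr))
  obtain ⟨x, hx⟩ := exists_zero_of_eq_id_outside hH (R := 2) (by norm_num) (fun x hx => by
    have : max 0 (min 1 (2 - ‖x‖)) = 0 := max_eq_left (min_le_of_right_le (by linarith))
    simp [H, this])
  rcases le_or_gt ‖x‖ 1 with h1 | h1
  · refine ⟨x, by simpa using h1, ?_⟩
    have hp : pr x = x := by simp [pr, max_eq_left h1]
    have hm : max 0 (min 1 (2 - ‖x‖)) = 1 := by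
      rw [min_eq_left (by linarith), max_eq_right zero_le_one]
    simpa [H, hp, hm] using hx
  · exfalso
    have h2 : max 0 (min 1 (2 - ‖x‖)) ≤ 1 := max_le zero_le_one (min_le_left _ _)
    have h3 : x = -(max 0 (min 1 (2 - ‖x‖)) • (q (pr x) - pr x)) := eq_neg_of_add_eq_zero_left hx
    have h4 : ‖x‖ ≤ 1 := by
      rw [h3, norm_neg, norm_smul, Real.norm_of_nonneg (le_max_left _ _)]
      exact mul_le_one₀ h2 (norm_nonneg _) (h _ (hprm x))
    linarith

/-- Let `G` extend the inverse of `f` continuously. If `f 0` is not interior, some `c` near it is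
missed, and the image can be pushed radially off a small ball around `c`. A perturbation `Q` of `G`
then has no zero on the pushed image, yet `Q ∘ Φ ∘ f` is close enough to the identity to be forced
to have one. -/
theorem image_zero_mem_interior [Nontrivial E] {f : E → E}
    (hf : ContinuousOn f (closedBall 0 1)) (hinj : InjOn f (closedBall 0 1)) :
    f 0 ∈ interior (f '' closedBall 0 1) := by
  borelize E
  by_contra hint
  let B : Set E := closedBall 0 1
  have h0B : (0 : E) ∈ B := by simp [B]
  have hBc : IsCompact B := isCompact_closedBall 0 1
  have : CompactSpace B := isCompact_iff_compactSpace.1 hBc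
  have hcl : IsClosedEmbedding (B.domRestrict f) :=
    (continuousOn_iff_continuous_domRestrict.1 hf).isClosedEmbedding (injOn_iff_injective.1 hinj)
  obtain ⟨G, hG⟩ := ContinuousMap.exists_extension hcl ⟨((↑) : B → E), continuous_subtype_val⟩
  have hGf : ∀ x ∈ B, G (f x) = x := fun x hx => DFunLike.congr_fun hG ⟨x, hx⟩
  have hK : IsCompact (f '' B) := hBc.image_of_continuousOn hf
  -- Radius `2 * ε`: the points concerned lie within `ε` of `c`, and `c` lies within `ε` of `f 0`.
  obtain ⟨ε, hε, hGε⟩ : ∃ ε > 0, ∀ y, ‖y - f 0‖ < 2 * ε → ‖G y‖ < 1 / 10 := by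
    have h1 : ContinuousAt G (f 0) := G.continuous.continuousAt
    obtain ⟨r, hr, h2⟩ := Metric.continuousAt_iff.1 h1 (1 / 10) (by norm_num)
    refine ⟨r / 2, by linarith, fun y hy => ?_⟩
    have := h2 (show dist y (f 0) < r by rw [dist_eq_norm]; linarith)
    rwa [hGf 0 h0B, dist_zero_right] at this
  obtain ⟨c, hc, hcK⟩ : ∃ c ∈ ball (f 0) ε, c ∉ f '' B := by
    by_contra! hsub
    exact hint (mem_interior_iff_mem_nhds.2 (mem_of_superset (ball_mem_nhds _ hε) hsub))
  rw [mem_ball, dist_eq_norm] at hc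
  -- One `δ` will be spent on smoothing `G`, the other on a translation.
  obtain ⟨δ, hδ, hδ', hmin⟩ : ∃ δ > 0, δ ≤ 1 / 10 ∧ ∀ y ∈ f '' B, ε ≤ ‖y - c‖ → 2 * δ ≤ ‖G y‖ := by
    have hS : IsCompact (f '' B ∩ {y | ε ≤ ‖y - c‖}) :=
      hK.inter_right (isClosed_le continuous_const (by fun_prop))
    rcases (f '' B ∩ {y | ε ≤ ‖y - c‖}).eq_empty_or_nonempty with he | hne
    · refine ⟨1 / 10, by norm_num, le_rfl, fun y hy hy' => ?_⟩
      exact absurd (show y ∈ f '' B ∩ {y | ε ≤ ‖y - c‖} from ⟨hy, hy'⟩) (by simp [he])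
    · obtain ⟨y₀, ⟨⟨x₀, hx₀, hxy⟩, hy₀'⟩, hmin⟩ := hS.exists_isMinOn hne G.continuous.norm.continuousOn
      have hpos : 0 < ‖G y₀‖ := by
        rw [norm_pos_iff, ← hxy, hGf x₀ hx₀]
        rintro rfl
        rw [← hxy, mem_ofPred_eq, norm_sub_rev] at hy₀'
        linarith
      refine ⟨min (1 / 10) (‖G y₀‖ / 2), lt_min (by norm_num) (by linarith), min_le_left _ _,
        fun y hy hy' => ?_⟩
      have h1 : ‖G y₀‖ ≤ ‖G y‖ := hmin ⟨hy, hy'⟩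
      linarith [min_le_right (1 / 10) (‖G y₀‖ / 2)]
  obtain ⟨P, hP, hPG⟩ := exists_contDiff_approx G G.continuous hδ
  -- A differentiable map sends the null set `sphere c ε` to a null set, so a small translation by
  -- `p` removes all zeros from it.
  obtain ⟨p, hp, hps⟩ : ∃ p ∈ ball (0 : E) δ, p ∉ P '' sphere c ε := by
    by_contra! hsub
    have h1 : volume (P '' sphere c ε) = 0 :=
      addHaar_image_eq_zero_of_differentiableOn_of_addHaar_eq_zero volume
        (hP.differentiable one_ne_zero).differentiableOn (Measure.addHaar_sphere volume c ε)
    exact (measure_ball_pos volume (0 : E) hδ).ne' (measure_mono_null hsub h1)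
  rw [mem_ball, dist_zero_right] at hp
  let Q : E → E := fun y => P y - p
  have hQG : ∀ y, ‖Q y - G y‖ < 2 * δ := by
    intro y
    have : Q y - G y = (P y - G y) - p := by simp only [Q]; abel
    rw [this]
    linarith [norm_sub_le (P y - G y) p, hPG y]
  -- Radial push of the punctured ball around `c` onto its boundary sphere, the identity elsewhere.
  let Φ : E → E := fun y => c + max (ε / ‖y - c‖) 1 • (y - c)
  have hΦ1 : ∀ y, ε ≤ ‖y - c‖ → Φ y = y := by
    intro y hy
    have : max (ε / ‖y - c‖) 1 = 1 := max_eq_right (div_le_one_of_le₀ hy (norm_nonneg _))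
    simp [Φ, this]
  have hΦ2 : ∀ y, y ≠ c → ‖y - c‖ < ε → ‖Φ y - c‖ = ε := by
    intro y hyc hy
    have hpos : 0 < ‖y - c‖ := norm_pos_iff.2 (sub_ne_zero.2 hyc)
    have : max (ε / ‖y - c‖) 1 = ε / ‖y - c‖ := max_eq_left ((one_le_div hpos).2 hy.le)
    simp only [Φ, this, add_sub_cancel_left, norm_smul, norm_div, norm_norm,
      Real.norm_of_nonneg hε.le]
    rw [div_mul_cancel₀ _ hpos.ne']
  have hΦc : ContinuousOn Φ (f '' B) := by
    have : ∀ y ∈ f '' B, ‖y - c‖ ≠ 0 := fun y hy =>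
      norm_ne_zero_iff.2 (sub_ne_zero.2 fun h => hcK (h ▸ hy))
    fun_prop (disch := assumption)
  obtain ⟨x, hx, hx0⟩ := exists_zero_of_norm_sub_le_one (q := fun x => Q (Φ (f x)))
    (by
      have : Continuous Q := hP.continuous.sub continuous_const
      exact this.comp_continuousOn (hΦc.comp hf (mapsTo_image f B)))
    (fun x hx => by
      have hy : f x ∈ f '' B := mem_image_of_mem f hx
      have hGx := hGf x hx
      rcases le_or_gt ε ‖f x - c‖ with h1 | h1
      · simp only [hΦ1 _ h1]
        have := hQG (f x)
        rw [hGx] at this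
        linarith
      · have h2 := hΦ2 _ (fun h => hcK (h ▸ hy)) h1
        have h3 : ‖G (Φ (f x))‖ < 1 / 10 := by
          refine hGε _ ?_
          have := norm_add_le (Φ (f x) - c) (c - f 0)
          rw [sub_add_sub_cancel] at this
          linarith
        have h4 : ‖G (f x)‖ < 1 / 10 := by
          refine hGε _ ?_
          have := norm_add_le (f x - c) (c - f 0)
          rw [sub_add_sub_cancel] at this
          linarith
        rw [hGx] at h4
        have h5 := hQG (Φ (f x))
        have h6 := norm_sub_le (Q (Φ (f x)) - G (Φ (f x)) + G (Φ (f x))) x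
        have h7 := norm_add_le (Q (Φ (f x)) - G (Φ (f x))) (G (Φ (f x)))
        rw [sub_add_cancel] at h6 h7
        linarith)
  have hy : f x ∈ f '' B := mem_image_of_mem f hx
  rcases le_or_gt ε ‖f x - c‖ with h1 | h1
  · simp only [hΦ1 _ h1] at hx0
    have h2 := hQG (f x)
    rw [hx0, zero_sub, norm_neg] at h2
    linarith [hmin _ hy h1]
  · have h2 := hΦ2 _ (fun h => hcK (h ▸ hy)) h1
    exact hps ⟨Φ (f x), by simpa [dist_eq_norm] using h2, sub_eq_zero.1 hx0⟩

theorem isOpen_image_self [Nontrivial E] {f : E → E} {U : Set E} (hU : IsOpen U)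
    (hf : ContinuousOn f U) (hinj : InjOn f U) : IsOpen (f '' U) := by
  rw [isOpen_iff_mem_nhds]
  rintro _ ⟨x, hx, rfl⟩
  obtain ⟨r, hr, hsub⟩ := nhds_basis_closedBall.mem_iff.1 (hU.mem_nhds hx)
  have hmaps : MapsTo (fun y : E => x + r • y) (closedBall 0 1) U := by
    intro y hy
    refine hsub ?_
    rw [mem_closedBall, dist_zero_right] at hy
    rw [mem_closedBall, dist_eq_norm, add_sub_cancel_left, norm_smul, Real.norm_of_nonneg hr.le]
    exact mul_le_of_le_one_right hr.le hy
  have h := image_zero_mem_interior (f := fun y => f (x + r • y))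
    (hf.comp (by fun_prop) hmaps)
    (fun y hy z hz hyz => by
      have := hinj (hmaps hy) (hmaps hz) hyz
      exact smul_right_injective E hr.ne' (add_left_cancel this))
  simp only [smul_zero, add_zero] at h
  refine mem_of_superset (mem_interior_iff_mem_nhds.1 h) ?_
  rintro _ ⟨y, hy, rfl⟩
  exact ⟨_, hmaps hy, rfl⟩

end Brouwer

/-- **Invariance of domain**. -/
theorem isOpen_image {E F : Type*} [NormedAddCommGroup E] [NormedSpace ℝ E] [FiniteDimensional ℝ E]
    [NormedAddCommGroup F] [NormedSpace ℝ F] [FiniteDimensional ℝ F] [Nontrivial E]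
    (hdim : finrank ℝ E = finrank ℝ F) {f : E → F} {U : Set E} (hU : IsOpen U)
    (hf : ContinuousOn f U) (hinj : InjOn f U) : IsOpen (f '' U) := by
  let X := EuclideanSpace ℝ (Fin (finrank ℝ E))
  let φ : X ≃L[ℝ] E := ContinuousLinearEquiv.ofFinrankEq (by simp [X])
  let ψ : F ≃L[ℝ] X := ContinuousLinearEquiv.ofFinrankEq (by simp [X, hdim])
  have : Nontrivial X := φ.toEquiv.nontrivial
  have h := isOpen_image_self (f := fun x => ψ (f (φ x))) (hU.preimage φ.continuous)
    (ψ.continuous.comp_continuousOn (hf.comp φ.continuous.continuousOn fun x hx => hx))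
    (fun x hx y hy hxy => φ.injective (hinj hx hy (ψ.injective hxy)))
  have h2 := h.preimage ψ.continuous
  convert h2 using 1
  ext y
  constructor
  · rintro ⟨x, hx, rfl⟩
    exact ⟨φ.symm x, by simpa using hx, by simp⟩
  · rintro ⟨x, hx, hxy⟩
    exact ⟨φ x, hx, ψ.injective hxy⟩

end InvarianceOfDomain

end

/-! ### Exchanging arcs of spanning trees -/

namespace SimpleGraph

variable {N : Type*}

/-- Replace the arc `ab` of a graph by the arc `uv`. -/
def swapArc (T : SimpleGraph N) (a b u v : N) : SimpleGraph N :=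
  (T ⊔ edge u v).deleteEdges {s(a, b)}

theorem swapArc_adj {T : SimpleGraph N} {a b u v x y : N} :
    (T.swapArc a b u v).Adj x y ↔
      (T.Adj x y ∨ (s(x, y) = s(u, v) ∧ x ≠ y)) ∧ s(x, y) ≠ s(a, b) := by
  simp [swapArc, edge_adj, deleteEdges_adj]
  tauto

/-- The swap can be undone: put `ab` back and drop `uv`. -/
theorem swapArc_injective {T₁ T₂ : SimpleGraph N} {a b u v : N} (h₁ : T₁.Adj a b)
    (h₂ : T₂.Adj a b) (h₁' : ¬ T₁.Adj u v) (h₂' : ¬ T₂.Adj u v)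
    (h : T₁.swapArc a b u v = T₂.swapArc a b u v) : T₁ = T₂ := by
  ext x y
  have hxy : (T₁.swapArc a b u v).Adj x y ↔ (T₂.swapArc a b u v).Adj x y := by rw [h]
  rw [swapArc_adj, swapArc_adj] at hxy
  simp only [← mem_edgeSet] at hxy h₁ h₂ h₁' h₂' ⊢
  by_cases h1 : s(x, y) = s(a, b)
  · rw [h1]; exact iff_of_true h₁ h₂
  by_cases h2 : s(x, y) = s(u, v)
  · rw [h2]; exact iff_of_false h₁' h₂'
  simpa [h1, h2] using hxy

/-- Adding `uv` closes the path to a cycle, none of whose arcs is a bridge. Deleting `ab` therefore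
keeps the graph connected and restores the number of arcs of a tree. -/
theorem IsTree.swapArc [Finite N] {T : SimpleGraph N} (hT : T.IsTree) {a b u v : N}
    (hne : u ≠ v) (huv : ¬ T.Adj u v) {p : T.Walk v u} (hp : p.IsPath)
    (hab : s(a, b) ∈ p.edges) : (T.swapArc a b u v).IsTree := by
  classical
  have hle : T ≤ T ⊔ edge u v := le_sup_left
  have hconn : (T ⊔ edge u v).Connected := hT.connected.mono hle
  have hadj : (T ⊔ edge u v).Adj u v := Or.inr (by simp [edge_adj, hne])
  let q : (T ⊔ edge u v).Walk v u := p.mapLe hle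
  have hq : q.IsPath := (Walk.isPath_mapLe hle).2 hp
  have hqe : q.edges = p.edges := Walk.edges_mapLe_eq_edges hle p
  have huvp : s(u, v) ∉ q.edges := by
    rw [hqe]
    exact fun h => huv (p.adj_of_mem_edges h)
  have hcyc : (Walk.cons hadj q).IsCycle := (Walk.cons_isCycle_iff q hadj).2 ⟨hq, huvp⟩
  have hbr : ¬ (T ⊔ edge u v).IsBridge s(a, b) := fun h =>
    h.notMem_edges_of_isCycle hcyc (by simp [hqe, hab])
  have hTab : T.Adj a b := p.adj_of_mem_edges hab
  rw [isTree_iff_connected_and_card] at hT ⊢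
  refine ⟨hconn.connected_delete_edge_of_not_isBridge hbr, ?_⟩
  rw [← hT.2, Nat.card_coe_set_eq, Nat.card_coe_set_eq]
  have h1 : (T ⊔ edge u v).edgeSet = insert s(u, v) T.edgeSet := by
    rw [edgeSet_sup, edgeSet_edge_of_ne hne, Set.union_singleton]
  rw [SimpleGraph.swapArc, edgeSet_deleteEdges, h1,
    Set.ncard_sdiff_singleton_of_mem (Set.mem_insert_of_mem _ (T.mem_edgeSet.2 hTab)),
    Set.ncard_insert_of_notMem (mt T.mem_edgeSet.1 huv)]
  simp

/-- In a tree missing all arcs between `v` and `U ∋ u`, an arc `uv` can be exchanged for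
either of the first two arcs of the path from `v` to `u`. -/
theorem IsTree.exists_exchange [Finite N] {T : SimpleGraph N} (hT : T.IsTree) {U : Set N} {u v : N}
    (hu : u ∈ U) (hv : v ∉ U) (hvU : ∀ w ∈ U, ¬ T.Adj v w) :
    ∃ w x, T.Adj v w ∧ T.Adj w x ∧ x ≠ v ∧ w ≠ u ∧ (T.swapArc v w u v).IsTree ∧
      (T.swapArc w x u v).IsTree := by
  obtain ⟨p, hp⟩ := hT.connected.exists_isPath v u
  have hne : u ≠ v := fun h => hv (h ▸ hu)
  have huv : ¬ T.Adj u v := fun h => hvU u hu h.symm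
  match p, hp with
  | .nil, _ => exact absurd rfl hne
  | .cons h .nil, _ => exact absurd h.symm huv
  | .cons (v := w) h (.cons (v := x) h' p'), hp =>
    refine ⟨w, x, h, h', ?_, ?_, hT.swapArc hne huv hp (by simp), hT.swapArc hne huv hp (by simp)⟩
    · rintro rfl
      rw [Walk.cons_isPath_iff] at hp
      exact hp.2 (by simp)
    · rintro rfl
      exact huv h.symm

open Classical in
/-- Local estimate for spanning trees containing a forest `F` supported on `U ∋ u`: trees
having no arc from `v` to `U` are at most `3 |W| / 4` times as many as those containing `uv`, where
`W` is the set of neighbours of `v` outside `U`. -/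
theorem card_trees_exchange [Fintype N] (G F : SimpleGraph N) (U : Set N) {u v : N}
    (hu : u ∈ U) (hv : v ∉ U) (hF : ∀ x y, F.Adj x y → x ∈ U ∧ y ∈ U) (huv : G.Adj u v)
    (W : Finset N) (hW : ∀ w, w ∈ W ↔ G.Adj v w ∧ w ∉ U)
    (hdeg : ∀ w ∈ W, {x | G.Adj w x ∧ x ≠ v}.ncard ≤ 3) :
    4 * {T : SimpleGraph N | T ∈ {T | T ≤ G ∧ T.IsTree} ∧ F ≤ T ∧ ∀ w ∈ U, ¬ T.Adj v w}.ncard ≤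
      3 * W.card * {T : SimpleGraph N | T ∈ {T | T ≤ G ∧ T.IsTree} ∧ F ≤ T ∧ T.Adj u v}.ncard := by
  have : Fintype (SimpleGraph N) := Fintype.ofFinite _
  let 𝒯₀ : Finset (SimpleGraph N) := Finset.univ.filter fun T =>
    T ∈ {T : SimpleGraph N | T ≤ G ∧ T.IsTree} ∧ F ≤ T ∧ ∀ w ∈ U, ¬ T.Adj v w
  let 𝒯₁ : Finset (SimpleGraph N) := Finset.univ.filter fun T =>
    T ∈ {T : SimpleGraph N | T ≤ G ∧ T.IsTree} ∧ F ≤ T ∧ T.Adj u v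
  have hne : u ≠ v := huv.ne
  have hex : ∀ T : SimpleGraph N, ∃ w x, T ∈ 𝒯₀ → T.Adj v w ∧ T.Adj w x ∧ x ≠ v ∧ w ≠ u ∧
      (T.swapArc v w u v).IsTree ∧ (T.swapArc w x u v).IsTree := by
    intro T
    by_cases hT : T ∈ 𝒯₀
    · have h := (Finset.mem_filter.1 hT).2
      obtain ⟨w, x, h⟩ := h.1.2.exists_exchange hu hv h.2.2
      exact ⟨w, x, fun _ => h⟩
    · exact ⟨u, u, fun h => absurd h hT⟩
  choose w x hwx using hex
  have hnuv : ∀ T ∈ 𝒯₀, ¬ T.Adj u v := fun T hT h =>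
    (Finset.mem_filter.1 hT).2.2.2 u hu h.symm
  have hwU : ∀ T ∈ 𝒯₀, w T ∉ U := fun T hT h =>
    (Finset.mem_filter.1 hT).2.2.2 _ h (hwx T hT).1
  have hwW : ∀ T ∈ 𝒯₀, w T ∈ W := fun T hT =>
    (hW _).2 ⟨(Finset.mem_filter.1 hT).2.1.1 (hwx T hT).1, hwU T hT⟩
  have hmem : ∀ T ∈ 𝒯₀, ∀ a b, a ∉ U → s(u, v) ≠ s(a, b) →
      (T.swapArc a b u v).IsTree → T.swapArc a b u v ∈ 𝒯₁ := by
    intro T hT a b ha hab htree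
    have h := (Finset.mem_filter.1 hT).2
    refine Finset.mem_filter.2 ⟨Finset.mem_univ _, ⟨fun y z hyz => ?_, htree⟩, fun y z hyz => ?_, ?_⟩
    · rw [swapArc_adj] at hyz
      rcases hyz.1 with h1 | ⟨h1, -⟩
      · exact h.1.1 h1
      · rw [← mem_edgeSet, h1]; exact huv
    · rw [swapArc_adj]
      refine ⟨Or.inl (h.2.1 hyz), fun h1 => ha ?_⟩
      obtain ⟨h2, h3⟩ := hF y z hyz
      rcases Sym2.eq_iff.1 h1 with ⟨rfl, rfl⟩ | ⟨rfl, rfl⟩ <;> assumption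
    · rw [swapArc_adj]
      exact ⟨Or.inr ⟨rfl, hne⟩, hab⟩
  have hmap₁ : ∀ T ∈ 𝒯₀, T.swapArc v (w T) u v ∈ 𝒯₁ := fun T hT =>
    hmem T hT _ _ hv (by
      intro h
      rcases Sym2.eq_iff.1 h with ⟨h, -⟩ | ⟨h, -⟩
      · exact hne h
      · exact (hwx T hT).2.2.2.1 h.symm) (hwx T hT).2.2.2.2.1
  have hmap₂ : ∀ T ∈ 𝒯₀, T.swapArc (w T) (x T) u v ∈ 𝒯₁ := fun T hT =>
    hmem T hT _ _ (hwU T hT) (by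
      intro h
      rcases Sym2.eq_iff.1 h with ⟨h, -⟩ | ⟨-, h⟩
      · exact (hwx T hT).2.2.2.1 h.symm
      · exact (hwx T hT).1.ne h) (hwx T hT).2.2.2.2.2
  -- `C T'` separates the two exchanges: the first deletes `vw`, so `w` lies outside `C T'`, while
  -- the second keeps `vw`, so `w` lies inside it.
  let C : SimpleGraph N → Finset N := fun T' => W.filter fun w => T'.Adj v w
  have hfib₁ : ∀ T' ∈ 𝒯₁, (𝒯₀.filter fun T => T.swapArc v (w T) u v = T').card ≤
      (W \ C T').card := by
    intro T' _
    refine Finset.card_le_card_of_injOn w ?_ ?_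
    · intro T hT
      obtain ⟨hT', rfl⟩ := Finset.mem_filter.1 (Finset.mem_coe.1 hT)
      refine Finset.mem_sdiff.2 ⟨hwW T hT', fun h => ?_⟩
      have := (Finset.mem_filter.1 h).2
      rw [swapArc_adj] at this
      exact this.2 rfl
    · intro T₁ hT₁ T₂ hT₂ h
      obtain ⟨hT₁, h₁⟩ := Finset.mem_filter.1 hT₁
      obtain ⟨hT₂, h₂⟩ := Finset.mem_filter.1 hT₂
      rw [← h₂] at h₁
      have a₂ := (hwx T₂ hT₂).1
      rw [← h] at h₁ a₂
      exact swapArc_injective (hwx T₁ hT₁).1 a₂ (hnuv _ hT₁) (hnuv _ hT₂) h₁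
  -- The pair `(w, x)` determines the original tree, and each `w` admits at most three choices of
  -- `x`.
  have hfib₂ : ∀ T' ∈ 𝒯₁, (𝒯₀.filter fun T => T.swapArc (w T) (x T) u v = T').card ≤
      3 * (C T').card := by
    intro T' _
    let Nb : N → Finset N := fun w => Finset.univ.filter fun x => G.Adj w x ∧ x ≠ v
    have hcard : ((C T').sigma Nb).card ≤ 3 * (C T').card := by
      rw [Finset.card_sigma, mul_comm, ← smul_eq_mul]
      refine Finset.sum_le_card_nsmul _ _ _ fun w hw => ?_
      have := hdeg w (Finset.mem_filter.1 hw).1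
      rwa [Set.ncard_eq_toFinset_card', Set.toFinset_ofPred] at this
    refine le_trans (Finset.card_le_card_of_injOn (fun T => (⟨w T, x T⟩ : Σ _ : N, N)) ?_ ?_) hcard
    · intro T hT
      obtain ⟨hT', rfl⟩ := Finset.mem_filter.1 (Finset.mem_coe.1 hT)
      have h := hwx T hT'
      refine Finset.mem_coe.2 (Finset.mem_sigma.2 ⟨Finset.mem_filter.2 ⟨hwW T hT', ?_⟩,
        Finset.mem_filter.2 ⟨Finset.mem_univ _, (Finset.mem_filter.1 hT').2.1.1 h.2.1, h.2.2.1⟩⟩)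
      rw [swapArc_adj]
      refine ⟨Or.inl h.1, fun h1 => ?_⟩
      rcases Sym2.eq_iff.1 h1 with ⟨h2, -⟩ | ⟨h2, -⟩
      · exact h.1.ne h2
      · exact h.2.2.1 h2.symm
    · intro T₁ hT₁ T₂ hT₂ h
      obtain ⟨hT₁, h₁⟩ := Finset.mem_filter.1 hT₁
      obtain ⟨hT₂, h₂⟩ := Finset.mem_filter.1 hT₂
      rw [← h₂] at h₁
      simp only [Sigma.mk.injEq, heq_eq_eq] at h
      have a₂ := (hwx T₂ hT₂).2.1
      rw [← h.1, ← h.2] at h₁ a₂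
      exact swapArc_injective (hwx T₁ hT₁).2.1 a₂ (hnuv _ hT₁) (hnuv _ hT₂) h₁
  have hsum₁ := Finset.card_eq_sum_card_fiberwise (f := fun T => T.swapArc v (w T) u v)
    (s := 𝒯₀) (t := 𝒯₁) fun T hT => hmap₁ T hT
  have hsum₂ := Finset.card_eq_sum_card_fiberwise (f := fun T => T.swapArc (w T) (x T) u v)
    (s := 𝒯₀) (t := 𝒯₁) fun T hT => hmap₂ T hT
  have hmain : 4 * 𝒯₀.card ≤ 3 * W.card * 𝒯₁.card := by
    -- Weighting the first exchange by `3` makes the two fibre bounds add up to `3 |W|`, whatever `C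
    -- T'` is.
    calc 4 * 𝒯₀.card = 3 * 𝒯₀.card + 𝒯₀.card := by ring
      _ ≤ 3 * ∑ T' ∈ 𝒯₁, (W \ C T').card + ∑ T' ∈ 𝒯₁, 3 * (C T').card := by
        gcongr
        · rw [hsum₁]; exact Finset.sum_le_sum hfib₁
        · rw [hsum₂]; exact Finset.sum_le_sum hfib₂
      _ = ∑ T' ∈ 𝒯₁, 3 * W.card := by
        rw [Finset.mul_sum, ← Finset.sum_add_distrib]
        refine Finset.sum_congr rfl fun T' _ => ?_
        rw [← mul_add, Finset.card_sdiff_add_card_eq_card (Finset.filter_subset _ _)]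
      _ = 3 * W.card * 𝒯₁.card := by rw [Finset.sum_const, smul_eq_mul, mul_comm]
  rw [Set.ncard_eq_toFinset_card', Set.ncard_eq_toFinset_card', Set.toFinset_ofPred,
    Set.toFinset_ofPred]
  exact hmain

end SimpleGraph

/-! ### Spanning trees along a chordless cycle -/

namespace SimpleGraph

variable {N : Type*}

theorem ncard_neighbor_ne_le {G : SimpleGraph N} {d : ℕ} (hdeg : ∀ n, {x | G.Adj n x}.ncard ≤ d + 1)
    {v w : N} (h : G.Adj w v) : {x | G.Adj w x ∧ x ≠ v}.ncard ≤ d := by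
  have h1 : {x | G.Adj w x ∧ x ≠ v} = {x | G.Adj w x} \ {v} := rfl
  rw [h1, Set.ncard_sdiff_singleton_of_mem (show v ∈ {x | G.Adj w x} from h)]
  have := hdeg w
  omega

/-- The closing arc would be a bridge although the chain joins its ends. With `m ≥ 2` the chain
avoids that arc. -/
theorem IsAcyclic.not_closed_chain {T : SimpleGraph N} (hT : T.IsAcyclic) {D : ℕ → N} {m : ℕ}
    (hm : 2 ≤ m) (hD : Set.InjOn D (Set.Iic m)) (h : ∀ i < m, T.Adj (D i) (D (i + 1)))
    (hm' : T.Adj (D m) (D 0)) : False := by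
  have hb := isAcyclic_iff_forall_adj_isBridge.1 hT hm'
  rw [isBridge_iff] at hb
  refine hb (Reachable.symm ?_)
  have hreach : ∀ i ≤ m, (T.deleteEdges {s(D m, D 0)}).Reachable (D 0) (D i) := by
    intro i
    induction i with
    | zero => exact fun _ => Reachable.refl _
    | succ i ih =>
      intro hi
      refine (ih (by omega)).trans (Adj.reachable ?_)
      rw [deleteEdges_adj]
      refine ⟨h i (by omega), fun h1 => ?_⟩
      rcases Sym2.eq_iff.1 (Set.mem_singleton_iff.1 h1) with ⟨h2, -⟩ | ⟨h2, h3⟩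
      · have := hD (Set.mem_Iic.2 (by omega)) (Set.mem_Iic.2 le_rfl) h2
        omega
      · have := hD (Set.mem_Iic.2 (by omega)) (Set.mem_Iic.2 (by omega)) h2
        have := hD (Set.mem_Iic.2 (by omega)) (Set.mem_Iic.2 le_rfl) h3
        omega
  exact hreach m le_rfl

/-- In a connected graph of maximal degree at most `4`, a positive proportion of spanning
trees contains all but one arc of a given chordless cycle `D 0, …, D (m + 2)`. -/
theorem proportion_trees_chordless_cycle [Fintype N] {G : SimpleGraph N} (hconn : G.Connected)
    (hdeg : ∀ n, {x | G.Adj n x}.ncard ≤ 4) {D : ℕ → N} {m : ℕ}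
    (hD : Set.InjOn D (Set.Iic (m + 2))) (hadj : ∀ i < m + 2, G.Adj (D i) (D (i + 1)))
    (hlast : G.Adj (D (m + 2)) (D 0))
    (hchord : ∀ i j, i < j → j ≤ m + 2 → G.Adj (D j) (D i) → j = i + 1 ∨ (i = 0 ∧ j = m + 2)) :
    (4 / 7 : ℝ) * (4 / 13) ^ (m + 1) ≤
      ({T | T ∈ G.spanningTrees ∧ (∀ i < m + 1, T.Adj (D i) (D (i + 1))) ∧
        Xor (T.Adj (D (m + 1)) (D (m + 2))) (T.Adj (D 0) (D (m + 2)))}.ncard : ℝ) /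
      (G.spanningTrees.ncard : ℝ) := by
  classical
  let A : ℕ → Set (SimpleGraph N) := fun j =>
    {T | T ∈ G.spanningTrees ∧ ∀ i < j, T.Adj (D i) (D (i + 1))}
  let F : ℕ → SimpleGraph N := fun j => fromEdgeSet {e | ∃ i < j, e = s(D i, D (i + 1))}
  have hF : ∀ j (T : SimpleGraph N), j ≤ m + 2 →
      (F j ≤ T ↔ ∀ i < j, T.Adj (D i) (D (i + 1))) := by
    intro j T hj
    refine ⟨fun h i hi => h ?_, fun h x y hxy => ?_⟩
    · rw [fromEdgeSet_adj]
      exact ⟨⟨i, hi, rfl⟩, (hadj i (by omega)).ne⟩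
    · rw [fromEdgeSet_adj] at hxy
      obtain ⟨⟨i, hi, he⟩, -⟩ := hxy
      rw [← mem_edgeSet, he]
      exact h i hi
  have hFU : ∀ j x y, (F j).Adj x y → x ∈ D '' Set.Iic j ∧ y ∈ D '' Set.Iic j := by
    intro j x y hxy
    rw [fromEdgeSet_adj] at hxy
    obtain ⟨⟨i, hi, he⟩, -⟩ := hxy
    have h1 : D i ∈ D '' Set.Iic j := ⟨i, Set.mem_Iic.2 hi.le, rfl⟩
    have h2 : D (i + 1) ∈ D '' Set.Iic j := ⟨i + 1, Set.mem_Iic.2 hi, rfl⟩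
    rcases Sym2.eq_iff.1 he with ⟨rfl, rfl⟩ | ⟨rfl, rfl⟩
    · exact ⟨h1, h2⟩
    · exact ⟨h2, h1⟩
  have hnot : ∀ j, j + 1 ≤ m + 2 → D (j + 1) ∉ D '' Set.Iic j := by
    rintro j hj ⟨i, hi, he⟩
    have := hD (Set.mem_Iic.2 (by have := Set.mem_Iic.1 hi; omega)) (Set.mem_Iic.2 hj) he
    have := Set.mem_Iic.1 hi
    omega
  let W : ℕ → Finset N := fun j =>
    Finset.univ.filter fun w => G.Adj (D (j + 1)) w ∧ w ∉ D '' Set.Iic j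
  have hW : ∀ j w, w ∈ W j ↔ G.Adj (D (j + 1)) w ∧ w ∉ D '' Set.Iic j := fun j w => by
    simp [W]
  have hex : ∀ j ≤ m + 1, ∀ u ∈ D '' Set.Iic j, G.Adj u (D (j + 1)) →
      4 * {T : SimpleGraph N | T ∈ {T | T ≤ G ∧ T.IsTree} ∧ F j ≤ T ∧
          ∀ w ∈ D '' Set.Iic j, ¬ T.Adj (D (j + 1)) w}.ncard ≤
        3 * (W j).card * {T : SimpleGraph N | T ∈ {T | T ≤ G ∧ T.IsTree} ∧ F j ≤ T ∧
          T.Adj u (D (j + 1))}.ncard := by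
    intro j hj u hu huv
    refine card_trees_exchange G (F j) (D '' Set.Iic j) hu (hnot j (by omega)) (hFU j) huv (W j)
      (hW j) fun w hw => ?_
    exact ncard_neighbor_ne_le hdeg ((hW j w).1 hw).1.symm
  have hWsub : ∀ j ≤ m + 1, (W j).card ≤ 3 := by
    intro j hj
    refine le_trans ?_ (ncard_neighbor_ne_le hdeg (hadj j (by omega)).symm)
    rw [← Set.ncard_coe_finset]
    refine Set.ncard_le_ncard fun w hw => ?_
    have h := (hW j w).1 hw
    exact ⟨h.1, fun h1 => h.2 ⟨j, Set.mem_Iic.2 le_rfl, h1.symm⟩⟩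
  -- With `|W| ≤ 3`, the trees of `A j` outside `A (j + 1)` number at most `9/4` times `A (j + 1)`.
  -- Chordlessness ensures that they have no arc from `D (j + 1)` to the path.
  have hstep : ∀ j ≤ m, 4 * (A j).ncard ≤ 13 * (A (j + 1)).ncard := by
    intro j hj
    have h1 := hex j (by omega) (D j) ⟨j, Set.mem_Iic.2 le_rfl, rfl⟩ (hadj j (by omega))
    have h2 := hWsub j (by omega)
    set X₀ : Set (SimpleGraph N) := {T : SimpleGraph N | T ∈ {T | T ≤ G ∧ T.IsTree} ∧ F j ≤ T ∧
          ∀ w ∈ D '' Set.Iic j, ¬ T.Adj (D (j + 1)) w}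
    set X₁ : Set (SimpleGraph N) := {T : SimpleGraph N | T ∈ {T | T ≤ G ∧ T.IsTree} ∧ F j ≤ T ∧
          T.Adj (D j) (D (j + 1))}
    have h3 : X₁ ⊆ A (j + 1) := by
      rintro T ⟨hT, hFT, ha⟩
      refine ⟨hT, fun i hi => ?_⟩
      rcases Nat.lt_succ_iff_lt_or_eq.1 hi with hi | rfl
      · exact (hF j T (by omega)).1 hFT i hi
      · exact ha
    have h4 : A j ⊆ X₀ ∪ A (j + 1) := by
      rintro T ⟨hT, hTj⟩
      by_cases ha : T.Adj (D j) (D (j + 1))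
      · right
        refine ⟨hT, fun i hi => ?_⟩
        rcases Nat.lt_succ_iff_lt_or_eq.1 hi with hi | rfl
        · exact hTj i hi
        · exact ha
      · left
        refine ⟨hT, (hF j T (by omega)).2 hTj, ?_⟩
        rintro _ ⟨i, hi, rfl⟩ h
        have hi := Set.mem_Iic.1 hi
        rcases hchord i (j + 1) (by omega) (by omega) (hT.1 h) with h5 | h5
        · obtain rfl : j = i := by omega
          exact ha h.symm
        · omega
    have h5 := Set.ncard_le_ncard h3 (Set.toFinite _)
    have h6 := (Set.ncard_le_ncard h4 (Set.toFinite _)).trans (Set.ncard_union_le _ _)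
    have h7 : 3 * (W j).card * X₁.ncard ≤ 9 * (A (j + 1)).ncard :=
      Nat.mul_le_mul (by omega) h5
    omega
  set good : Set (SimpleGraph N) := {T | T ∈ G.spanningTrees ∧
    (∀ i < m + 1, T.Adj (D i) (D (i + 1))) ∧
    Xor (T.Adj (D (m + 1)) (D (m + 2))) (T.Adj (D 0) (D (m + 2)))} with hgood
  -- Both path ends are neighbours of the last node, so `|W| ≤ 2`. The failing trees are at most
  -- `3/2` times each of the disjoint classes `X₁` and `X₂`, hence at most `3/4` times the good
  -- ones.
  have hfinal : 4 * (A (m + 1)).ncard ≤ 7 * good.ncard := by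
    have h1 := hex (m + 1) le_rfl (D (m + 1)) ⟨m + 1, Set.mem_Iic.2 le_rfl, rfl⟩
      (hadj (m + 1) (by omega))
    have h2 := hex (m + 1) le_rfl (D 0) ⟨0, Set.mem_Iic.2 (by omega), rfl⟩ hlast.symm
    have hW2 : (W (m + 1)).card ≤ 2 := by
      have h3 := ncard_neighbor_ne_le hdeg hlast
      have h4 : {x | G.Adj (D (m + 2)) x ∧ x ≠ D 0} \ {D (m + 1)} ⊇ W (m + 1) := by
        intro w hw
        have h := (hW (m + 1) w).1 hw
        exact ⟨⟨h.1, fun h1 => h.2 ⟨0, Set.mem_Iic.2 (by omega), h1.symm⟩⟩,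
          fun h1 => h.2 ⟨m + 1, Set.mem_Iic.2 le_rfl, h1.symm⟩⟩
      have h5 := Set.ncard_le_ncard h4 (Set.toFinite _)
      rw [Set.ncard_coe_finset, Set.ncard_sdiff_singleton_of_mem] at h5
      · omega
      · refine ⟨(hadj (m + 1) (by omega)).symm, fun h => ?_⟩
        have := hD (Set.mem_Iic.2 (by omega)) (Set.mem_Iic.2 (by omega)) h
        omega
    set X₀ : Set (SimpleGraph N) := {T : SimpleGraph N | T ∈ {T | T ≤ G ∧ T.IsTree} ∧
      F (m + 1) ≤ T ∧ ∀ w ∈ D '' Set.Iic (m + 1), ¬ T.Adj (D (m + 1 + 1)) w}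
    set X₁ : Set (SimpleGraph N) := {T : SimpleGraph N | T ∈ {T | T ≤ G ∧ T.IsTree} ∧
      F (m + 1) ≤ T ∧ T.Adj (D (m + 1)) (D (m + 1 + 1))}
    set X₂ : Set (SimpleGraph N) := {T : SimpleGraph N | T ∈ {T | T ≤ G ∧ T.IsTree} ∧
      F (m + 1) ≤ T ∧ T.Adj (D 0) (D (m + 1 + 1))}
    have hdisj : ∀ T ∈ G.spanningTrees, F (m + 1) ≤ T → T.Adj (D (m + 1)) (D (m + 2)) →
        T.Adj (D 0) (D (m + 2)) → False := by
      intro T hT hFT ha hb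
      refine hT.2.isAcyclic.not_closed_chain (m := m + 2) (by omega) hD (fun i hi => ?_) hb.symm
      rcases Nat.lt_succ_iff_lt_or_eq.1 hi with hi | rfl
      · exact (hF _ T (by omega)).1 hFT i hi
      · exact ha
    have h3 : X₁ ∪ X₂ ⊆ good := by
      rintro T (⟨hT, hFT, ha⟩ | ⟨hT, hFT, ha⟩)
      · exact ⟨hT, (hF _ T (by omega)).1 hFT, Or.inl ⟨ha, fun hb => hdisj T hT hFT ha hb⟩⟩
      · exact ⟨hT, (hF _ T (by omega)).1 hFT, Or.inr ⟨ha, fun hb => hdisj T hT hFT hb ha⟩⟩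
    have h4 : A (m + 1) ⊆ X₀ ∪ good := by
      rintro T ⟨hT, hTj⟩
      have hFT := (hF _ T (by omega)).2 hTj
      by_cases ha : T.Adj (D (m + 1)) (D (m + 2))
      · exact Or.inr ⟨hT, hTj, Or.inl ⟨ha, fun hb => hdisj T hT hFT ha hb⟩⟩
      by_cases hb : T.Adj (D 0) (D (m + 2))
      · exact Or.inr ⟨hT, hTj, Or.inr ⟨hb, ha⟩⟩
      left
      refine ⟨hT, hFT, ?_⟩
      rintro _ ⟨i, hi, rfl⟩ h
      have hi := Set.mem_Iic.1 hi
      rcases hchord i (m + 2) (by omega) (by omega) (hT.1 h) with h5 | h5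
      · obtain rfl : m + 1 = i := by omega
        exact ha h.symm
      · obtain ⟨rfl, -⟩ := h5
        exact hb h.symm
    have h5 : X₁.ncard + X₂.ncard ≤ good.ncard := by
      rw [← Set.ncard_union_eq _ (Set.toFinite _) (Set.toFinite _)]
      · exact Set.ncard_le_ncard h3 (Set.toFinite _)
      · rw [Set.disjoint_left]
        rintro T ⟨hT, hFT, ha⟩ ⟨-, -, hb⟩
        exact hdisj T hT hFT ha hb
    have h6 := (Set.ncard_le_ncard h4 (Set.toFinite _)).trans (Set.ncard_union_le _ _)
    have h7 : 3 * (W (m + 1)).card * X₁.ncard ≤ 6 * X₁.ncard := Nat.mul_le_mul (by omega) le_rfl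
    have h8 : 3 * (W (m + 1)).card * X₂.ncard ≤ 6 * X₂.ncard := Nat.mul_le_mul (by omega) le_rfl
    omega
  have hA0 : A 0 = G.spanningTrees := by ext T; simp [A]
  have hpos : 0 < (G.spanningTrees.ncard : ℝ) := by
    obtain ⟨T, hT, hT'⟩ := hconn.exists_isTree_le
    have : G.spanningTrees.Nonempty := ⟨T, hT, hT'⟩
    exact_mod_cast (Set.ncard_pos (Set.toFinite _)).2 this
  have hind : ∀ j ≤ m + 1, (4 / 13 : ℝ) ^ j * (G.spanningTrees.ncard : ℝ) ≤ (A j).ncard := by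
    intro j
    induction j with
    | zero => intro _; rw [hA0]; simp
    | succ j ih =>
      intro hj
      have h1 := ih (by omega)
      have h2 : (4 : ℝ) * (A j).ncard ≤ 13 * (A (j + 1)).ncard := by
        exact_mod_cast hstep j (by omega)
      rw [pow_succ]
      linarith
  rw [le_div_iff₀ hpos]
  have h1 := hind (m + 1) le_rfl
  have h2 : (4 : ℝ) * (A (m + 1)).ncard ≤ 7 * good.ncard := by exact_mod_cast hfinal
  linarith

end SimpleGraph

/-! ### Invariance of domain for triangulated spheres -/

section

open Set Filter Topology Module

namespace InvarianceOfDomain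

variable {n : ℕ} {X : Type*} [TopologicalSpace X] [ChartedSpace (EuclideanSpace ℝ (Fin n)) X]
  {E : Type*} [NormedAddCommGroup E] [NormedSpace ℝ E] [FiniteDimensional ℝ E]

theorem isOpen_image_of_chartedSpace [Nontrivial E] (hdim : finrank ℝ E = n) {g : E → X} {U : Set E}
    (hU : IsOpen U) (hg : ContinuousOn g U) (hinj : InjOn g U) : IsOpen (g '' U) := by
  rw [isOpen_iff_mem_nhds]
  rintro _ ⟨x, hx, rfl⟩
  let c := chartAt (EuclideanSpace ℝ (Fin n)) (g x)
  have hU' : IsOpen (U ∩ g ⁻¹' c.source) := hg.isOpen_inter_preimage hU c.open_source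
  have h1 : IsOpen ((fun y => c (g y)) '' (U ∩ g ⁻¹' c.source)) := by
    refine isOpen_image (by simp [hdim]) hU' ?_ ?_
    · exact c.continuousOn.comp (hg.mono inter_subset_left) fun y hy => hy.2
    · intro y hy z hz hyz
      exact hinj hy.1 hz.1 (c.injOn hy.2 hz.2 hyz)
  have h2 := c.isOpen_image_symm_of_subset_target h1 (by
    rintro _ ⟨y, hy, rfl⟩
    exact c.map_source hy.2)
  refine mem_of_superset (h2.mem_nhds ⟨c (g x), ⟨x, ⟨hx, ?_⟩, rfl⟩, ?_⟩) ?_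
  · exact mem_chart_source _ (g x)
  · exact c.left_inv (mem_chart_source _ (g x))
  · rintro _ ⟨_, ⟨y, hy, rfl⟩, rfl⟩
    exact ⟨y, hy.1, (c.left_inv hy.2).symm⟩

theorem isOpen_image_chartedSpace (hn : n ≠ 0) (hdim : finrank ℝ E = n) {g : X → E} {U : Set X}
    (hU : IsOpen U) (hg : ContinuousOn g U) (hinj : InjOn g U) : IsOpen (g '' U) := by
  have : Nonempty (Fin n) := ⟨⟨0, Nat.pos_of_ne_zero hn⟩⟩
  rw [isOpen_iff_mem_nhds]
  rintro _ ⟨x, hx, rfl⟩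
  let c := chartAt (EuclideanSpace ℝ (Fin n)) x
  have hW : IsOpen (c '' (U ∩ c.source)) :=
    c.isOpen_image_of_subset_source (hU.inter c.open_source) inter_subset_right
  have h1 : IsOpen ((fun y => g (c.symm y)) '' (c '' (U ∩ c.source))) := by
    refine isOpen_image (by simp [hdim]) hW ?_ ?_
    · refine hg.comp (c.symm.continuousOn.mono ?_) ?_
      · rintro _ ⟨y, hy, rfl⟩
        exact c.map_source hy.2
      · rintro _ ⟨y, hy, rfl⟩
        simpa [c.left_inv hy.2] using hy.1
    · rintro _ ⟨y, hy, rfl⟩ _ ⟨z, hz, rfl⟩ hyz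
      simp only [c.left_inv hy.2, c.left_inv hz.2] at hyz
      rw [hinj hy.1 hz.1 hyz]
  have hxs : x ∈ c.source := mem_chart_source _ x
  refine mem_of_superset (h1.mem_nhds ⟨c x, ⟨x, ⟨hx, hxs⟩, rfl⟩, by simp [c.left_inv hxs]⟩) ?_
  rintro _ ⟨_, ⟨y, hy, rfl⟩, rfl⟩
  exact ⟨y, hy.1, by simp [c.left_inv hy.2]⟩

end InvarianceOfDomain

namespace PreAbstractSimplicialComplex

variable {V : Type*} [Fintype V] {S : PreAbstractSimplicialComplex V}

theorem mem_realization_of_subset {y : V → ℝ} (hy : y ∈ stdSimplex ℝ V) {D : Finset V}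
    (hD : D ∈ S.faces) (h : ∀ v, y v ≠ 0 → v ∈ D) : y ∈ S.realization := by
  classical
  refine ⟨hy, Finset.univ.filter fun v => y v ≠ 0, ?_, by simp⟩
  refine (S.isRelLowerSet_faces hD).2 (fun v hv => h v (Finset.mem_filter.1 hv).2) ?_
  by_contra hne
  rw [Finset.not_nonempty_iff_eq_empty, Finset.filter_eq_empty_iff] at hne
  have h0 : ∀ v, y v = 0 := fun v => not_not.1 (hne (Finset.mem_univ v))
  have := hy.2
  simp [h0] at this

/-- Move from `x` slightly towards the vertex `d`: the segment stays in the simplex `D`. -/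
theorem exists_mem_nhdsWithin_pos {x : V → ℝ} (hx : x ∈ stdSimplex ℝ V) {D : Finset V}
    (hD : D ∈ S.faces) (hxD : ∀ v, x v ≠ 0 → v ∈ D) {d : V} (hd : d ∈ D) {N : Set (V → ℝ)}
    (hN : N ∈ 𝓝[S.realization] x) : ∃ y ∈ N, 0 < y d := by
  classical
  let γ : ℝ → V → ℝ := fun ε => (1 - ε) • x + ε • Pi.single d 1
  have hγ : Continuous γ := by fun_prop
  have hγ0 : γ 0 = x := by simp [γ]
  have hmem : ∀ ε ∈ Ioo (0 : ℝ) 1, γ ε ∈ S.realization := by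
    intro ε hε
    refine mem_realization_of_subset ?_ hD fun v hv => ?_
    · exact convex_stdSimplex ℝ V hx (single_mem_stdSimplex ℝ d) (by linarith [hε.2]) hε.1.le
        (by ring)
    · by_contra hvD
      have h1 : x v = 0 := by_contra fun h => hvD (hxD v h)
      have h2 : v ≠ d := fun h => hvD (h ▸ hd)
      simp [γ, h1, h2] at hv
  have ht : Tendsto γ (𝓝[>] 0) (𝓝[S.realization] x) := by
    refine tendsto_nhdsWithin_iff.2 ⟨?_, ?_⟩
    · rw [← hγ0]; exact hγ.continuousAt.tendsto.mono_left nhdsWithin_le_nhds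
    · filter_upwards [Ioo_mem_nhdsGT (zero_lt_one' ℝ)] with ε hε using hmem ε hε
  obtain ⟨ε, hεN, hε⟩ := ((ht.eventually hN).and (Ioo_mem_nhdsGT (zero_lt_one' ℝ))).exists
  refine ⟨γ ε, hεN, ?_⟩
  have h1 := hx.1 d
  have h2 : γ ε d = (1 - ε) * x d + ε := by simp [γ]
  rw [h2]
  have := mul_nonneg (sub_nonneg.2 hε.2.le) h1
  linarith [hε.1]

theorem exists_facet_superset {d : ℕ} (hS : S.IsPureOfDim d) {s : Finset V} (hs : s ∈ S.faces) :
    ∃ D ∈ S.faces, D.card = d + 1 ∧ s ⊆ D := by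
  obtain ⟨D, hsD, hD⟩ := (Set.toFinite S.faces).exists_le_maximal hs
  exact ⟨D, hD.prop, hS D hD, hsD⟩

namespace IsSphereTriangulation

variable {E : Type*} [NormedAddCommGroup E] [NormedSpace ℝ E] [FiniteDimensional ℝ E]
  {d : ℕ}

theorem image_mem_nhdsWithin [Nontrivial E] (hS : S.IsSphereTriangulation d) (hdim : finrank ℝ E = d)
    {g : E → V → ℝ} {U : Set E} (hU : IsOpen U) (hg : ContinuousOn g U) (hinj : InjOn g U)
    (hmaps : MapsTo g U S.realization) {x : E} (hx : x ∈ U) :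
    g '' U ∈ 𝓝[S.realization] (g x) := by
  classical
  obtain ⟨h⟩ := hS.homeo
  let g' : E → S.realization := fun y => if hy : g y ∈ S.realization then ⟨g y, hy⟩ else
    ⟨g x, hmaps hx⟩
  have hg' : ∀ y ∈ U, (g' y : V → ℝ) = g y := fun y hy => by simp [g', hmaps hy]
  have hcont : ContinuousOn g' U := by
    rw [Topology.IsInducing.subtypeVal.continuousOn_iff]
    exact hg.congr hg'
  have hopen : IsOpen ((h ∘ g') '' U) :=
    InvarianceOfDomain.isOpen_image_of_chartedSpace hdim hU (h.continuous.comp_continuousOn hcont)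
      fun y hy z hz hyz => hinj hy hz (by rw [← hg' y hy, ← hg' z hz, h.injective hyz])
  rw [image_comp, h.isOpen_image] at hopen
  have hmem : g' '' U ∈ 𝓝 (g' x) := hopen.mem_nhds (mem_image_of_mem _ hx)
  have hx' : g' x = ⟨g x, hmaps hx⟩ := Subtype.ext (hg' x hx)
  rw [hx'] at hmem
  rw [nhdsWithin_eq_map_subtype_coe (hmaps hx), mem_map]
  refine mem_of_superset hmem ?_
  rintro _ ⟨y, hy, rfl⟩
  exact ⟨y, hy, (hg' y hy).symm⟩

theorem image_mem_nhds (hS : S.IsSphereTriangulation d) (hd : d ≠ 0) (hdim : finrank ℝ E = d)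
    {g : (V → ℝ) → E} {N : Set (V → ℝ)} (hN : IsOpen N) (hg : Continuous g)
    (hinj : InjOn g (N ∩ S.realization)) {x : V → ℝ} (hxN : x ∈ N) (hx : x ∈ S.realization) :
    g '' (N ∩ S.realization) ∈ 𝓝 (g x) := by
  obtain ⟨h⟩ := hS.homeo
  let N' : Set S.realization := Subtype.val ⁻¹' N
  have hN' : IsOpen N' := hN.preimage continuous_subtype_val
  have hopen : IsOpen ((fun y => g (h.symm y)) '' (h '' N')) :=
    InvarianceOfDomain.isOpen_image_chartedSpace (n := d) hd hdim (h.isOpen_image.2 hN')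
      (hg.comp (continuous_subtype_val.comp h.symm.continuous)).continuousOn (by
        rintro _ ⟨y, hy, rfl⟩ _ ⟨z, hz, rfl⟩ hyz
        simp only [Homeomorph.symm_apply_apply] at hyz
        rw [Subtype.ext (hinj ⟨hy, y.2⟩ ⟨hz, z.2⟩ hyz)])
  refine mem_of_superset (hopen.mem_nhds ⟨h ⟨x, hx⟩, ⟨⟨x, hx⟩, hxN, rfl⟩, by simp⟩) ?_
  rintro _ ⟨_, ⟨y, hy, rfl⟩, rfl⟩
  exact ⟨y, ⟨hy, y.2⟩, by simp⟩

/-- If the link of a face `σ` contains an embedded copy of a neighbourhood of `0` in a cone of the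
right dimension, then this copy meets all vertices of the link. -/
theorem exists_link_chart_ne_zero (hS : S.IsSphereTriangulation d) {σ : Finset V} {r : V}
    (hr : r ∈ σ) {F : Type*} [NormedAddCommGroup F] [NormedSpace ℝ F] [FiniteDimensional ℝ F]
    [Nontrivial F] (hdim : σ.card + finrank ℝ F = d + 1) {τ : F → V → ℝ} (hτ : Continuous τ)
    (hinj : Function.Injective τ) (h0 : τ 0 = 0) (hnonneg : ∀ w v, 0 ≤ τ w v)
    (hσ : ∀ w, ∀ v ∈ σ, τ w v = 0)
    (hface : ∀ w, ∃ D ∈ S.faces, σ ⊆ D ∧ ∀ v, τ w v ≠ 0 → v ∈ D)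
    {c : V} (hc : c ∉ σ) {D' : Finset V} (hD' : D' ∈ S.faces) (hσD' : σ ⊆ D') (hcD' : c ∈ D') :
    ∃ w, τ w c ≠ 0 := by
  classical
  let A := ↥(σ.erase r) → ℝ
  let ext : A → V → ℝ := fun z v => if h : v ∈ σ.erase r then z ⟨v, h⟩ else 0
  have hext : Continuous ext := by
    refine continuous_pi fun v => ?_
    by_cases h : v ∈ σ.erase r
    · simp only [ext, h, dite_true]; fun_prop
    · simp only [ext, h, dite_false]; fun_prop
  have hextsum : ∀ z, ∑ v, ext z v = ∑ i, z i := by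
    intro z
    rw [← Finset.sum_subset (Finset.subset_univ (σ.erase r)) (fun v _ hv => by simp only [ext, hv, dite_false]),
      ← Finset.sum_coe_sort]
    exact Finset.sum_congr rfl fun i _ => by simp only [ext, i.2, dite_true]
  -- The coordinate at `r` is dictated by total mass one, so only the other vertices of `σ`
  -- contribute free parameters.
  let ρ : A × F → ℝ := fun p => 1 - ∑ i, p.1 i - ∑ v, τ p.2 v
  have hρ : Continuous ρ := by fun_prop
  let g : A × F → V → ℝ := fun p => τ p.2 + ext p.1 + Pi.single r (ρ p)
  have hg : Continuous g := by
    have h1 : Continuous fun p : A × F => (Pi.single r (ρ p) : V → ℝ) :=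
      (continuous_single r).comp hρ
    exact ((hτ.comp continuous_snd).add (hext.comp continuous_fst)).add h1
  have hgr : ∀ p, g p r = ρ p := fun p => by simp [g, ext, hσ p.2 r hr]
  have hgA : ∀ p (i : ↥(σ.erase r)), g p i = p.1 i := fun p i => by
    have h1 := Finset.mem_erase.1 i.2
    simp [g, ext, hσ p.2 i h1.2, h1.1, h1.2]
  have hgτ : ∀ p, ∀ v ∉ σ, g p v = τ p.2 v := fun p v hv => by
    have h1 : v ≠ r := fun h => hv (h ▸ hr)
    simp [g, ext, hv, h1]
  let U : Set (A × F) := {p | (∀ i, 0 < p.1 i) ∧ 0 < ρ p}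
  have hU : IsOpen U := by
    have h1 : U = (⋂ i, {p : A × F | 0 < p.1 i}) ∩ {p | 0 < ρ p} := by
      ext p; simp [U]
    rw [h1]
    exact (isOpen_iInter_of_finite fun i => isOpen_lt continuous_const (by fun_prop)).inter
      (isOpen_lt continuous_const hρ)
  have hginj : Function.Injective g := by
    rintro ⟨z, w⟩ ⟨z', w'⟩ h
    have h1 : z = z' := funext fun i => by
      have := hgA (z, w) i
      rw [h, hgA] at this
      exact this.symm
    have h2 : τ w = τ w' := funext fun v => by
      by_cases hv : v ∈ σ
      · rw [hσ _ v hv, hσ _ v hv]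
      · have := hgτ (z, w) v hv
        rw [h, hgτ _ v hv] at this
        exact this.symm
    rw [h1, hinj h2]
  have hsimplex : ∀ p ∈ U, g p ∈ stdSimplex ℝ V := by
    intro p hp
    refine ⟨fun v => ?_, ?_⟩
    · by_cases hv : v ∈ σ
      · by_cases hvr : v = r
        · rw [hvr, hgr]; exact hp.2.le
        · rw [hgA p ⟨v, Finset.mem_erase.2 ⟨hvr, hv⟩⟩]; exact (hp.1 _).le
      · rw [hgτ p v hv]; exact hnonneg _ _
    · simp only [g, Pi.add_apply, Finset.sum_add_distrib, hextsum, Finset.sum_pi_single',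
        Finset.mem_univ, if_true, ρ]
      simp only [Finset.univ_eq_attach]
      ring
  have hmaps : MapsTo g U S.realization := by
    intro p hp
    obtain ⟨D, hD, hσD, hτD⟩ := hface p.2
    refine mem_realization_of_subset (hsimplex p hp) hD fun v hv => ?_
    by_cases hvσ : v ∈ σ
    · exact hσD hvσ
    · rw [hgτ p v hvσ] at hv; exact hτD v hv
  have hcard : 0 < σ.card := Finset.card_pos.2 ⟨r, hr⟩
  -- The parameter of the barycentre of `σ`. By invariance of domain the image of `U` is a
  -- neighbourhood of it in the realization, so it contains points of `D'` with positive coordinate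
  -- at `c`.
  let x : A × F := (fun _ => 1 / (σ.card : ℝ), 0)
  have hx : x ∈ U := by
    refine ⟨fun i => by positivity, ?_⟩
    simp only [ρ, x, h0, Pi.zero_apply, Finset.sum_const_zero, sub_zero, Finset.sum_const,
      Finset.card_univ, Fintype.card_coe, Finset.card_erase_of_mem hr, nsmul_eq_mul]
    rw [Nat.cast_sub hcard, mul_one_div, sub_pos, div_lt_one (by positivity)]
    simp
  have hnhds := hS.image_mem_nhdsWithin (E := A × F) (by
    rw [Module.finrank_prod, Module.finrank_fintype_fun_eq_card, Fintype.card_coe,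
      Finset.card_erase_of_mem hr]
    omega) hU hg.continuousOn hginj.injOn hmaps hx
  obtain ⟨_, ⟨p, -, rfl⟩, hpos⟩ := exists_mem_nhdsWithin_pos (hsimplex x hx) hD' (fun v hv => by
    by_cases hvσ : v ∈ σ
    · exact hσD' hvσ
    · rw [hgτ x v hvσ] at hv
      simp [x, h0] at hv) hcD' hnhds
  rw [hgτ p c hc] at hpos
  exact ⟨p.2, hpos.ne'⟩

end IsSphereTriangulation

end PreAbstractSimplicialComplex

end

/-! ### Every ridge lies in exactly two facets -/

section

open Set Filter Topology Module

namespace PreAbstractSimplicialComplex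

variable {V : Type*} [Fintype V] [DecidableEq V] {S : PreAbstractSimplicialComplex V} {d : ℕ}

/-- If the facet were unique, the coordinates on `σ` would be an open chart at the barycentre of
`σ`. But its image lies in the half-space where the coordinates sum to at most one, with the
barycentre on the boundary. -/
theorem IsSphereTriangulation.exists_insert_mem_ne (hS : S.IsSphereTriangulation d) (hd : d ≠ 0)
    {σ : Finset V} (hσ : σ.card = d) {a : V} (ha : a ∉ σ) (haσ : insert a σ ∈ S.faces) :
    ∃ b ≠ a, b ∉ σ ∧ insert b σ ∈ S.faces := by
  by_contra! hall
  have hdpos : 0 < (d : ℝ) := by positivity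
  let N : Set (V → ℝ) := {y | ∀ v : σ, 0 < y v}
  have hN : IsOpen N := by
    have : N = ⋂ v : σ, {y : V → ℝ | 0 < y v} := by ext; simp [N]
    rw [this]
    exact isOpen_iInter_of_finite fun v => isOpen_lt continuous_const (continuous_apply _)
  let g : (V → ℝ) → σ → ℝ := fun y v => y v
  have hsupp : ∀ y ∈ N ∩ S.realization, ∀ v, v ≠ a → v ∉ σ → y v = 0 := by
    rintro y ⟨hyN, hy, s, hs, hys⟩ v hva hvσ
    by_contra hv
    refine hall v hva hvσ ((S.isRelLowerSet_faces hs).2 ?_ (Finset.insert_nonempty _ _))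
    intro w hw
    rcases Finset.mem_insert.1 hw with rfl | hw
    · exact (hys _).1 hv
    · exact (hys _).1 (hyN ⟨w, hw⟩).ne'
  have hsum : ∀ y ∈ N ∩ S.realization, y a + ∑ v : σ, y v = 1 := by
    intro y hy
    rw [← hy.2.1.2, Finset.sum_coe_sort σ y, ← Finset.sum_insert ha]
    refine Finset.sum_subset (Finset.subset_univ _) fun v _ hv => ?_
    rw [Finset.mem_insert, not_or] at hv
    exact hsupp y hy v hv.1 hv.2
  have hinj : InjOn g (N ∩ S.realization) := by
    intro y hy z hz hyz
    have hσ' : ∀ v : σ, y v = z v := fun v => congrFun hyz v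
    funext v
    by_cases hv : v ∈ σ
    · exact hσ' ⟨v, hv⟩
    by_cases hva : v = a
    · have h1 := hsum y hy
      have h2 := hsum z hz
      simp only [hσ'] at h1
      rw [hva]; linarith
    · rw [hsupp y hy v hva hv, hsupp z hz v hva hv]
  let x : V → ℝ := fun v => if v ∈ σ then 1 / (d : ℝ) else 0
  have hxs : x ∈ stdSimplex ℝ V := by
    refine ⟨fun v => ?_, ?_⟩
    · simp only [x]; split_ifs <;> positivity
    · simp only [x, Finset.sum_ite_mem, Finset.univ_inter, Finset.sum_const, hσ, nsmul_eq_mul]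
      field_simp
  have hxS : x ∈ S.realization := mem_realization_of_subset hxs haσ fun v hv => by
    by_contra h
    rw [Finset.mem_insert, not_or] at h
    simp [x, h.2] at hv
  have hxN : x ∈ N := fun v => by simp [x, v.2]; positivity
  have hnhds := hS.image_mem_nhds (E := σ → ℝ) hd (by simp [hσ]) hN (by fun_prop) hinj hxN hxS
  have hgx : g x = fun _ => 1 / (d : ℝ) := by
    funext v; simp [g, x, v.2]
  rw [hgx] at hnhds
  have hcont : Tendsto (fun t : ℝ => (fun _ : σ => t)) (𝓝[>] (1 / (d : ℝ)))
      (𝓝 fun _ => 1 / (d : ℝ)) := by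
    refine Tendsto.mono_left ?_ nhdsWithin_le_nhds
    exact (by fun_prop : Continuous fun t : ℝ => (fun _ : σ => t)).tendsto _
  -- All `d` coordinates equal to some `t > 1 / d`: their sum exceeds one.
  obtain ⟨t, ⟨y, hy, hyt⟩, ht⟩ := ((hcont.eventually hnhds).and self_mem_nhdsWithin).exists
  have h1 := hsum y hy
  have h2 : ∀ v : σ, y v = t := fun v => congrFun hyt v
  simp only [h2, Finset.sum_const, Finset.card_univ, Fintype.card_coe, hσ, nsmul_eq_mul] at h1
  have h3 := hy.2.1.1 a
  have h4 : 1 / (d : ℝ) < t := ht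
  rw [div_lt_iff₀ hdpos] at h4
  linarith

/-- The facets at `a` and `b` already form an open ball around the interior of `σ`: a line folded at
the origin, positive half towards `a` and negative half towards `b`, plays the role of the link
chart. It leaves no room for a third facet. -/
theorem IsSphereTriangulation.eq_or_eq_of_insert_mem (hS : S.IsSphereTriangulation d) (hd : d ≠ 0)
    {σ : Finset V} (hσ : σ.card = d) {a b c : V} (hab : a ≠ b) (ha : a ∉ σ) (hb : b ∉ σ)
    (hc : c ∉ σ) (haσ : insert a σ ∈ S.faces) (hbσ : insert b σ ∈ S.faces)
    (hcσ : insert c σ ∈ S.faces) : c = a ∨ c = b := by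
  obtain ⟨r, hr⟩ : σ.Nonempty := Finset.card_pos.1 (by omega)
  let τ : ℝ → V → ℝ := fun s => Pi.single a (max s 0) + Pi.single b (max (-s) 0)
  have hτa : ∀ s, τ s a = max s 0 := fun s => by simp [τ, hab]
  have hτb : ∀ s, τ s b = max (-s) 0 := fun s => by simp [τ, hab.symm]
  have hτ : ∀ s v, v ≠ a → v ≠ b → τ s v = 0 := fun s v h1 h2 => by simp [τ, h1, h2]
  have hcont : Continuous τ := by
    have h1 : ∀ (c : V) {f : ℝ → ℝ}, Continuous f →
        Continuous fun s => (Pi.single c (f s) : V → ℝ) :=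
      fun c f hf => (continuous_single c).comp hf
    exact (h1 a (by fun_prop)).add (h1 b (by fun_prop))
  have hinj : Function.Injective τ := by
    intro s t h
    have h1 := congrFun h a
    have h2 := congrFun h b
    rw [hτa, hτa] at h1
    rw [hτb, hτb] at h2
    rcases max_cases s 0 with h3 | h3 <;> rcases max_cases t 0 with h4 | h4 <;>
      rcases max_cases (-s) 0 with h5 | h5 <;> rcases max_cases (-t) 0 with h6 | h6 <;> linarith
  by_contra! hne
  obtain ⟨s, hs⟩ := hS.exists_link_chart_ne_zero hr (τ := τ) (by simp [hσ]) hcont hinj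
    (by funext v; simp [τ]) (fun s v => by
      by_cases h1 : v = a
      · rw [h1, hτa]; exact le_max_right _ _
      by_cases h2 : v = b
      · rw [h2, hτb]; exact le_max_right _ _
      rw [hτ s v h1 h2])
    (fun s v hv => hτ s v (fun h => ha (h ▸ hv)) (fun h => hb (h ▸ hv)))
    (fun s => by
      rcases le_total s 0 with h | h
      · refine ⟨_, hbσ, Finset.subset_insert _ _, fun v hv => ?_⟩
        by_contra hvb
        rw [Finset.mem_insert, not_or] at hvb
        by_cases h1 : v = a
        · rw [h1, hτa, max_eq_right h] at hv; exact hv rfl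
        · exact hv (hτ s v h1 hvb.1)
      · refine ⟨_, haσ, Finset.subset_insert _ _, fun v hv => ?_⟩
        by_contra hva
        rw [Finset.mem_insert, not_or] at hva
        by_cases h1 : v = b
        · rw [h1, hτb, max_eq_right (by linarith)] at hv; exact hv rfl
        · exact hv (hτ s v hva.1 h1))
    hc hcσ (Finset.subset_insert _ _) (Finset.mem_insert_self _ _)
  exact hs (hτ s c hne.1 hne.2)

/-- A triangulated sphere is a pseudomanifold: every ridge is contained in exactly two facets. -/
theorem IsSphereTriangulation.exists_two_facets (hS : S.IsSphereTriangulation d) (hd : d ≠ 0)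
    {σ : Finset V} (hσ : σ.card = d) (hσS : σ ∈ S.faces) :
    ∃ a b, a ≠ b ∧ ∀ c, (c ∉ σ ∧ insert c σ ∈ S.faces) ↔ (c = a ∨ c = b) := by
  obtain ⟨D, hD, hDc, hσD⟩ := exists_facet_superset hS.pure hσS
  obtain ⟨a, ha, rfl⟩ := Finset.exists_eq_insert_iff.2 ⟨hσD, by omega⟩
  obtain ⟨b, hba, hb, hbσ⟩ := hS.exists_insert_mem_ne hd hσ ha hD
  refine ⟨a, b, hba.symm, fun c => ⟨fun h => ?_, ?_⟩⟩
  · exact hS.eq_or_eq_of_insert_mem hd hσ hba.symm ha hb h.1 hD hbσ h.2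
  · rintro (rfl | rfl)
    · exact ⟨ha, hD⟩
    · exact ⟨hb, hbσ⟩

end PreAbstractSimplicialComplex

end

/-! ### A fan of sectors parametrizing the cone over a polygon -/

section

open Set Real

namespace PlaneFan

/-- The `i`-th coordinate of the fan of `m` congruent sectors covering the plane: it is positive
exactly on the open sector of angle `4 * π / m` centered at the direction `2 * π * i / m`. -/
noncomputable def tent (m i : ℕ) (w : ℂ) : ℝ :=
  max 0 (w.re * cos (2 * π / m * i) + w.im * sin (2 * π / m * i) - ‖w‖ * cos (2 * π / m))

theorem continuous_tent (m i : ℕ) : Continuous (tent m i) := by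
  unfold tent
  fun_prop

theorem tent_nonneg (m i : ℕ) (w : ℂ) : 0 ≤ tent m i w := le_max_left _ _

theorem tent_zero (m i : ℕ) : tent m i 0 = 0 := by simp [tent]

/-- Polar coordinates with the angle measured in units of `2 * π / m`, split into integral part `j`
and fractional part `s`. -/
theorem exists_sector {m : ℕ} (hm : 0 < m) (w : ℂ) : ∃ j < m, ∃ s ∈ Ico (0 : ℝ) 1,
    w.re = ‖w‖ * cos (2 * π / m * (j + s)) ∧ w.im = ‖w‖ * sin (2 * π / m * (j + s)) := by
  have hm' : (0 : ℝ) < m := by exact_mod_cast hm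
  obtain ⟨φ, hφ0, hφ1, hre, him⟩ : ∃ φ, 0 ≤ φ ∧ φ < 2 * π ∧ w.re = ‖w‖ * cos φ ∧
      w.im = ‖w‖ * sin φ := by
    rcases le_or_gt 0 w.arg with h | h
    · exact ⟨w.arg, h, by linarith [w.arg_le_pi, pi_pos], (Complex.norm_mul_cos_arg w).symm,
        (Complex.norm_mul_sin_arg w).symm⟩
    · refine ⟨w.arg + 2 * π, by linarith [w.neg_pi_lt_arg, pi_pos], by linarith, ?_, ?_⟩
      · rw [cos_add_two_pi]; exact (Complex.norm_mul_cos_arg w).symm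
      · rw [sin_add_two_pi]; exact (Complex.norm_mul_sin_arg w).symm
  have hq0 : 0 ≤ φ * m / (2 * π) := by positivity
  have hq1 : φ * m / (2 * π) < m := by
    rw [div_lt_iff₀ (by positivity)]
    nlinarith
  refine ⟨⌊φ * m / (2 * π)⌋₊, (Nat.floor_lt hq0).2 hq1, φ * m / (2 * π) - ⌊φ * m / (2 * π)⌋₊,
    ⟨sub_nonneg.2 (Nat.floor_le hq0), by linarith [Nat.lt_floor_add_one (φ * m / (2 * π))]⟩, ?_⟩
  have : 2 * π / m * (⌊φ * m / (2 * π)⌋₊ + (φ * m / (2 * π) - ⌊φ * m / (2 * π)⌋₊)) = φ := by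
    rw [add_sub_cancel]
    field_simp
  rw [this]
  exact ⟨hre, him⟩

theorem cos_le_of_mem {m : ℕ} (hm : 3 ≤ m) {x : ℝ} (h1 : 1 ≤ |x|) (h2 : |x| ≤ m - 1) :
    cos (2 * π / m * x) ≤ cos (2 * π / m) := by
  have hm' : (3 : ℝ) ≤ m := by exact_mod_cast hm
  have hδ : 0 < 2 * π / m := by positivity
  have hδm : 2 * π / m * m = 2 * π := by field_simp
  rw [← cos_abs, abs_mul, abs_of_pos hδ]
  rcases le_total (2 * π / m * |x|) π with h | h
  · exact cos_le_cos_of_nonneg_of_le_pi hδ.le h (by nlinarith)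
  · rw [← cos_two_pi_sub]
    exact cos_le_cos_of_nonneg_of_le_pi hδ.le (by linarith) (by nlinarith)

theorem strictAntiOn_cos_mul {m : ℕ} (hm : 3 ≤ m) :
    StrictAntiOn (fun s : ℝ => cos (2 * π / m * s)) (Icc 0 1) := by
  have hm' : (3 : ℝ) ≤ m := by exact_mod_cast hm
  have hδ : 0 < 2 * π / m := by positivity
  have hδπ : 2 * π / m ≤ π := by
    rw [div_le_iff₀ (by positivity)]
    nlinarith [pi_pos]
  intro s hs t ht hst
  refine strictAntiOn_cos ⟨by have := hs.1; positivity, ?_⟩ ⟨by have := ht.1; positivity, ?_⟩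
    (mul_lt_mul_of_pos_left hst hδ)
  · nlinarith [hs.2]
  · nlinarith [ht.2]

/-- Only directions less than one step away give a positive tent. In sector `j` these are `j` and
its cyclic successor, so the sector lands in the cone over one side of the polygon. -/
theorem tent_eq_of_sector {m : ℕ} (hm : 3 ≤ m) {w : ℂ} {j : ℕ} (hj : j < m) {s : ℝ}
    (hs : s ∈ Ico (0 : ℝ) 1) (hre : w.re = ‖w‖ * cos (2 * π / m * (j + s)))
    (him : w.im = ‖w‖ * sin (2 * π / m * (j + s))) {i : ℕ} (hi : i < m) :
    tent m i w = ‖w‖ * (if i = j then cos (2 * π / m * s) - cos (2 * π / m)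
      else if i = (j + 1) % m then cos (2 * π / m * (1 - s)) - cos (2 * π / m) else 0) := by
  have hm' : (3 : ℝ) ≤ m := by exact_mod_cast hm
  have hδm : 2 * π / m * m = 2 * π := by field_simp
  have h1 : tent m i w = ‖w‖ * max 0 (cos (2 * π / m * (j + s - i)) - cos (2 * π / m)) := by
    rw [mul_max_of_nonneg _ _ (norm_nonneg _), mul_zero, tent, mul_sub (2 * π / (m : ℝ)), cos_sub]
    congr 1
    rw [hre, him]
    ring
  have hanti := (strictAntiOn_cos_mul hm).antitoneOn
  rw [h1]
  congr 1
  split_ifs with hij hij'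
  · subst hij
    rw [show (i : ℝ) + s - i = s by ring]
    refine max_eq_right (sub_nonneg.2 ?_)
    simpa using hanti ⟨hs.1, hs.2.le⟩ ⟨zero_le_one, le_rfl⟩ hs.2.le
  · have h2 : cos (2 * π / m * (j + s - i)) = cos (2 * π / m * (1 - s)) := by
      rcases Nat.lt_or_ge (j + 1) m with hlt | hge
      · rw [Nat.mod_eq_of_lt hlt] at hij'
        rw [hij', ← cos_neg]
        congr 1
        push_cast
        ring
      · obtain rfl : m = j + 1 := by omega
        rw [Nat.mod_self] at hij'
        rw [hij', ← cos_two_pi_sub]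
        congr 1
        push_cast at hδm ⊢
        linear_combination -hδm
    rw [h2]
    refine max_eq_right (sub_nonneg.2 ?_)
    simpa using hanti (a := 1 - s) ⟨by linarith [hs.2], by linarith [hs.1]⟩ ⟨zero_le_one, le_rfl⟩
      (by linarith [hs.1])
  · refine max_eq_left (sub_nonpos.2 (cos_le_of_mem hm ?_ ?_))
    · rcases Nat.lt_or_gt_of_ne hij with hlt | hgt
      · have : (i : ℝ) + 1 ≤ j := by exact_mod_cast hlt
        rw [abs_of_nonneg (by linarith [hs.1])]
        linarith [hs.1]
      · have h3 : j + 2 ≤ i := by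
          have : i ≠ j + 1 := fun h => hij' (by rw [h, Nat.mod_eq_of_lt (h ▸ hi)])
          omega
        have : (j : ℝ) + 2 ≤ i := by exact_mod_cast h3
        rw [abs_of_neg (by linarith [hs.2])]
        linarith [hs.2]
    · rw [abs_le]
      have h4 : (i : ℝ) + 1 ≤ m := by exact_mod_cast hi
      have h5 : (j : ℝ) + 1 ≤ m := by exact_mod_cast hj
      refine ⟨by linarith [hs.1, Nat.cast_nonneg (α := ℝ) j], ?_⟩
      rcases Nat.lt_or_ge (j + 1) m with hlt | hge
      · have : (j : ℝ) + 2 ≤ m := by exact_mod_cast hlt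
        linarith [hs.2, Nat.cast_nonneg (α := ℝ) i]
      · have h6 : 1 ≤ i := by
          have : (j + 1) % m = 0 := by rw [show j + 1 = m by omega, Nat.mod_self]
          omega
        have : (1 : ℝ) ≤ i := by exact_mod_cast h6
        linarith [hs.2]

theorem tent_injective {m : ℕ} (hm : 3 ≤ m) {w z : ℂ} (h : ∀ i < m, tent m i w = tent m i z) :
    w = z := by
  obtain ⟨j, hj, s, hs, hre, him⟩ := exists_sector (by omega : 0 < m) w
  obtain ⟨k, hk, t, ht, hre', him'⟩ := exists_sector (by omega : 0 < m) z
  have hw := fun i hi => tent_eq_of_sector hm hj hs hre him (i := i) hi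
  have hz := fun i hi => tent_eq_of_sector hm hk ht hre' him' (i := i) hi
  set A : ℝ → ℝ := fun s => cos (2 * π / m * s) - cos (2 * π / m) with hA
  have hanti : ∀ a ∈ Icc (0 : ℝ) 1, ∀ b ∈ Icc (0 : ℝ) 1, a < b → A b < A a := fun a ha b hb hab =>
    sub_lt_sub_right (strictAntiOn_cos_mul hm ha hb hab) _
  have hA1 : A 1 = 0 := by simp [A]
  have hApos : ∀ a ∈ Ico (0 : ℝ) 1, 0 < A a := fun a ha => by
    rw [← hA1]; exact hanti a ⟨ha.1, ha.2.le⟩ 1 ⟨zero_le_one, le_rfl⟩ ha.2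
  have hs' : s ∈ Icc (0 : ℝ) 1 := ⟨hs.1, hs.2.le⟩
  have ht' : t ∈ Icc (0 : ℝ) 1 := ⟨ht.1, ht.2.le⟩
  have hwj : tent m j w = ‖w‖ * A s := by rw [hw j hj, if_pos rfl]
  have hzk : tent m k z = ‖z‖ * A t := by rw [hz k hk, if_pos rfl]
  have hmod : ∀ i < m, i ≠ (i + 1) % m := by
    intro i hi h
    rcases Nat.lt_or_ge (i + 1) m with hlt | hge
    · rw [Nat.mod_eq_of_lt hlt] at h; omega
    · rw [show i + 1 = m by omega, Nat.mod_self] at h; omega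
  have hzero : ∀ {x y : ℂ}, (∀ i < m, tent m i x = tent m i y) → ∀ {i : ℕ} {a : ℝ}, i < m →
      tent m i y = ‖y‖ * A a → a ∈ Ico (0 : ℝ) 1 → x = 0 → y = 0 := by
    rintro x y hxy i a hi hy ha rfl
    rw [← hxy i hi, tent_zero] at hy
    rcases mul_eq_zero.1 hy.symm with h0 | h0
    · exact norm_eq_zero.1 h0
    · exact absurd h0 (hApos a ha).ne'
  by_cases hw0 : w = 0
  · rw [hw0, hzero h hk hzk ht hw0]
  by_cases hz0 : z = 0
  · exact absurd (hzero (fun i hi => (h i hi).symm) hj hwj hs hz0) hw0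
  have hwpos : 0 < ‖w‖ := norm_pos_iff.2 hw0
  have hzpos : 0 < ‖z‖ := norm_pos_iff.2 hz0
  -- The tents at `j` and `k` are nonzero, so distinct sectors would have to be cyclic successors of
  -- each other, impossible for `m ≥ 3`.
  have hjk : j = k := by
    by_contra hne
    have h1 : j = (k + 1) % m := by
      by_contra h1
      have := h j hj
      rw [hwj, hz j hj, if_neg hne, if_neg h1, mul_zero] at this
      exact (mul_pos hwpos (hApos s hs)).ne' this
    have h2 : k = (j + 1) % m := by
      by_contra h2
      have := h k hk
      rw [hzk, hw k hk, if_neg (Ne.symm hne), if_neg h2, mul_zero] at this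
      exact (mul_pos hzpos (hApos t ht)).ne' this.symm
    rcases Nat.lt_or_ge (j + 1) m with hlt | hge <;> rcases Nat.lt_or_ge (k + 1) m with hlt' | hge'
    · rw [Nat.mod_eq_of_lt hlt'] at h1
      rw [Nat.mod_eq_of_lt hlt] at h2
      omega
    · rw [show k + 1 = m by omega, Nat.mod_self] at h1
      rw [Nat.mod_eq_of_lt hlt] at h2
      omega
    · rw [Nat.mod_eq_of_lt hlt'] at h1
      rw [show j + 1 = m by omega, Nat.mod_self] at h2
      omega
    · omega
  subst hjk
  have e1 : ‖w‖ * A s = ‖z‖ * A t := by rw [← hwj, ← hzk, h j hj]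
  have e2 : ‖w‖ * A (1 - s) = ‖z‖ * A (1 - t) := by
    have hlt : (j + 1) % m < m := Nat.mod_lt _ (by omega)
    have h1 := hw _ hlt
    have h2 := hz _ hlt
    rw [if_neg (hmod j hj).symm, if_pos rfl] at h1 h2
    rw [← h1, ← h2, h _ hlt]
  -- If `a < b`, the first equation forces `p < q`, and then the right side of the second is
  -- strictly larger.
  have key : ∀ {p q a b : ℝ}, 0 < p → 0 < q → a ∈ Ico (0 : ℝ) 1 → b ∈ Ico (0 : ℝ) 1 →
      p * A a = q * A b → p * A (1 - a) = q * A (1 - b) → ¬ a < b := by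
    intro p q a b hp hq ha hb h1 h2 hab
    have h3 := hanti a ⟨ha.1, ha.2.le⟩ b ⟨hb.1, hb.2.le⟩ hab
    have h4 := hanti (1 - b) ⟨by linarith [hb.2], by linarith [hb.1]⟩ (1 - a)
      ⟨by linarith [ha.2], by linarith [ha.1]⟩ (by linarith)
    have h5 : 0 ≤ A (1 - a) := by
      rcases ha.1.eq_or_lt with h0 | h0
      · rw [← h0, sub_zero, hA1]
      · exact (hApos _ ⟨by linarith [ha.2], by linarith⟩).le
    have h6 := hApos a ha
    have h7 : p < q := by
      by_contra hle
      nlinarith [not_lt.1 hle]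
    nlinarith
  have hst : s = t := le_antisymm (not_lt.1 (key hzpos hwpos ht hs e1.symm e2.symm))
    (not_lt.1 (key hwpos hzpos hs ht e1 e2))
  subst hst
  have hn : ‖w‖ = ‖z‖ := mul_right_cancel₀ (hApos s hs).ne' e1
  apply Complex.ext
  · rw [hre, hre', hn]
  · rw [him, him', hn]

end PlaneFan

end

/-! ### The link of a codimension two face is a cycle -/

section

open Set Module

namespace PreAbstractSimplicialComplex

variable {V : Type*} [DecidableEq V] {S : PreAbstractSimplicialComplex V} {d : ℕ}

/-- The graph underlying the link of a face. -/
def linkGraph (S : PreAbstractSimplicialComplex V) (σ : Finset V) : SimpleGraph V where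
  Adj v w := v ≠ w ∧ v ∉ σ ∧ w ∉ σ ∧ insert v (insert w σ) ∈ S.faces
  symm := ⟨fun v w h => ⟨h.1.symm, h.2.2.1, h.2.1, by rw [Finset.insert_comm]; exact h.2.2.2⟩⟩
  loopless := ⟨fun _ h => h.1 rfl⟩

theorem insert_mem_of_adj_linkGraph {σ : Finset V} {v w : V} (h : (S.linkGraph σ).Adj v w) :
    insert v σ ∈ S.faces :=
  (S.isRelLowerSet_faces h.2.2.2).2 (Finset.insert_subset_insert _ (Finset.subset_insert _ _))
    (Finset.insert_nonempty _ _)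

variable [Fintype V]

/-- The face `insert v σ` is a ridge, and its two facets give the two neighbours. -/
theorem IsSphereTriangulation.exists_neighborSet_linkGraph (hS : S.IsSphereTriangulation d)
    {σ : Finset V} (hσ : σ.card + 1 = d) {v : V} (hv : v ∉ σ) (hvσ : insert v σ ∈ S.faces) :
    ∃ a b, a ≠ b ∧ (S.linkGraph σ).neighborSet v = {a, b} := by
  obtain ⟨a, b, hab, h⟩ := hS.exists_two_facets (by omega)
    (by rw [Finset.card_insert_of_notMem hv, hσ]) hvσ
  refine ⟨a, b, hab, ?_⟩
  ext c
  rw [Set.mem_insert_iff, Set.mem_singleton_iff, ← h c, Finset.mem_insert, not_or,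
    Finset.insert_comm]
  exact ⟨fun h => ⟨⟨h.1.symm, h.2.2.1⟩, h.2.2.2⟩, fun h => ⟨Ne.symm h.1.1, hv, h.1.2, h.2⟩⟩

theorem IsSphereTriangulation.isCycles_linkGraph (hS : S.IsSphereTriangulation d)
    {σ : Finset V} (hσ : σ.card + 1 = d) : (S.linkGraph σ).IsCycles := by
  rintro v ⟨w, hw⟩
  obtain ⟨a, b, hab, h⟩ := hS.exists_neighborSet_linkGraph hσ hw.2.1
    (insert_mem_of_adj_linkGraph hw)
  rw [h, Set.ncard_pair hab]

/-- A closed cycle in the link of a codimension two face passes through all vertices of the link. -/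
theorem IsSphereTriangulation.mem_link_cycle (hS : S.IsSphereTriangulation d) {σ : Finset V}
    (hσ : σ.card + 1 = d) (hne : σ.Nonempty) {m : ℕ} (hm : 3 ≤ m) {c : ℕ → V}
    (hinj : InjOn c (Iio m)) (hcm : c m = c 0)
    (hadj : ∀ i < m, (S.linkGraph σ).Adj (c i) (c (i + 1))) {w : V} (hw : w ∉ σ)
    (hwσ : insert w σ ∈ S.faces) : ∃ i < m, w = c i := by
  obtain ⟨r, hr⟩ := hne
  -- Embeds the plane as the cone over the cycle `c`; it vanishes at every vertex off the cycle.
  let τ : ℂ → V → ℝ := fun z => ∑ i ∈ Finset.range m, Pi.single (c i) (PlaneFan.tent m i z)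
  have hτ1 : ∀ z v, (∀ i < m, v ≠ c i) → τ z v = 0 := by
    intro z v hv
    simp only [τ, Finset.sum_apply]
    exact Finset.sum_eq_zero fun i hi =>
      Pi.single_eq_of_ne (hv i (Finset.mem_range.1 hi)) _
  have hτ2 : ∀ z, ∀ i < m, τ z (c i) = PlaneFan.tent m i z := by
    intro z i hi
    simp only [τ, Finset.sum_apply]
    rw [Finset.sum_eq_single i]
    · simp
    · intro j hj hji
      exact Pi.single_eq_of_ne (fun h => hji (hinj (Finset.mem_range.1 hj) hi h.symm)) _
    · exact fun h => absurd (Finset.mem_range.2 hi) h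
  have hcont : Continuous τ :=
    continuous_finsetSum _ fun i _ => (continuous_single (c i)).comp (PlaneFan.continuous_tent m i)
  by_contra! hall
  have hzero : ∀ z, τ z w = 0 := fun z => hτ1 z w hall
  obtain ⟨z, hz⟩ := hS.exists_link_chart_ne_zero hr (τ := τ)
    (by rw [Complex.finrank_real_complex]; omega) hcont
    (fun y z hyz => PlaneFan.tent_injective hm fun i hi => by rw [← hτ2 y i hi, hyz, hτ2 z i hi])
    (by
      funext v
      simp [τ, PlaneFan.tent_zero])
    (fun z v => by
      by_cases hv : ∃ i < m, v = c i
      · obtain ⟨i, hi, rfl⟩ := hv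
        rw [hτ2 z i hi]; exact PlaneFan.tent_nonneg _ _ _
      · rw [hτ1 z v (by push Not at hv; exact hv)])
    (fun z v hv => hτ1 z v fun i hi h => (hadj i hi).2.1 (h ▸ hv))
    (fun z => by
      obtain ⟨j, hj, s, hs, hre, him⟩ := PlaneFan.exists_sector (by omega : 0 < m) z
      refine ⟨_, (hadj j hj).2.2.2, (Finset.subset_insert _ _).trans (Finset.subset_insert _ _),
        fun v hv => ?_⟩
      by_contra hvD
      rw [Finset.mem_insert, Finset.mem_insert, not_or, not_or] at hvD
      by_cases hvc : ∃ i < m, v = c i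
      · obtain ⟨i, hi, rfl⟩ := hvc
        rw [hτ2 z i hi, PlaneFan.tent_eq_of_sector hm hj hs hre him hi,
          if_neg (fun h => hvD.1 (by rw [h])), if_neg, mul_zero] at hv
        · exact hv rfl
        · intro h
          rcases Nat.lt_or_ge (j + 1) m with hlt | hge
          · rw [Nat.mod_eq_of_lt hlt] at h
            exact hvD.2.1 (by rw [h])
          · have hjm : j + 1 = m := by omega
            rw [hjm, Nat.mod_self] at h
            exact hvD.2.1 (by rw [h, hjm, hcm])
      · exact hv (hτ1 z v (by push Not at hvc; exact hvc)))
    hw hwσ (Finset.subset_insert _ _) (Finset.mem_insert_self _ _)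
  exact hz (hzero z)

/-- In a triangulated sphere, the link of a codimension two face is a single cycle. -/
theorem IsSphereTriangulation.exists_link_cycle (hS : S.IsSphereTriangulation d) {σ : Finset V}
    (hσ : σ.card + 1 = d) (hne : σ.Nonempty) (hσS : σ ∈ S.faces) :
    ∃ (m : ℕ) (c : ℕ → V), 3 ≤ m ∧ InjOn c (Iio m) ∧ c m = c 0 ∧
      (∀ i < m, (S.linkGraph σ).Adj (c i) (c (i + 1))) ∧
      ∀ v w, (S.linkGraph σ).Adj v w →
        ∃ i < m, (v = c i ∧ w = c (i + 1)) ∨ (w = c i ∧ v = c (i + 1)) := by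
  obtain ⟨D, hD, hDc, hσD⟩ := exists_facet_superset hS.pure hσS
  have hcard : (D \ σ).card = 2 := by
    rw [Finset.card_sdiff_of_subset hσD]; omega
  obtain ⟨v, w, hvw, hDσ⟩ := Finset.card_eq_two.1 hcard
  have hv : v ∈ D \ σ := by simp [hDσ]
  have hw : w ∈ D \ σ := by simp [hDσ]
  rw [Finset.mem_sdiff] at hv hw
  have hadj : (S.linkGraph σ).Adj v w := by
    refine ⟨hvw, hv.2, hw.2, (S.isRelLowerSet_faces hD).2 ?_ (Finset.insert_nonempty _ _)⟩
    exact Finset.insert_subset hv.1 (Finset.insert_subset hw.1 hσD)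
  obtain ⟨p, hp, -⟩ := (hS.isCycles_linkGraph hσ).exists_cycle_toSubgraph_verts_eq_connectedComponentSupp
    (c := (S.linkGraph σ).connectedComponentMk v) rfl ⟨w, hadj⟩
  have hm := hp.three_le_length
  have hinj : InjOn p.getVert (Iio p.length) := fun i hi j hj h => by
    have h1 := mem_Iio.1 hi
    have h2 := mem_Iio.1 hj
    exact hp.getVert_injOn' (by rw [Set.mem_ofPred_eq]; omega) (by rw [Set.mem_ofPred_eq]; omega) h
  have hcm : p.getVert p.length = p.getVert 0 := by simp
  have hadj' : ∀ i < p.length, (S.linkGraph σ).Adj (p.getVert i) (p.getVert (i + 1)) :=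
    fun i hi => p.adj_getVert_succ hi
  refine ⟨p.length, p.getVert, hm, hinj, hcm, hadj', fun x y hxy => ?_⟩
  obtain ⟨i, hi, rfl⟩ := hS.mem_link_cycle hσ hne hm hinj hcm hadj' hxy.2.1
    (insert_mem_of_adj_linkGraph hxy)
  obtain ⟨a, b, -, hab⟩ := hS.exists_neighborSet_linkGraph hσ hxy.2.1
    (insert_mem_of_adj_linkGraph hxy)
  have hnb : ∀ z, (S.linkGraph σ).Adj (p.getVert i) z → z = a ∨ z = b := fun z hz => by
    have : z ∈ (S.linkGraph σ).neighborSet (p.getVert i) := hz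
    rwa [hab] at this
  -- The cyclic predecessor of `i`. It and the successor are distinct, so they exhaust the two
  -- neighbours in the link.
  obtain ⟨k, hk, hki, hk'⟩ : ∃ k < p.length, p.getVert (k + 1) = p.getVert i ∧
      p.getVert k ≠ p.getVert (i + 1) := by
    rcases Nat.eq_zero_or_pos i with rfl | hi0
    · refine ⟨p.length - 1, by omega, ?_, fun h => ?_⟩
      · rw [Nat.sub_add_cancel (by omega), hcm]
      · have := hinj (mem_Iio.2 (by omega)) (mem_Iio.2 (by omega)) h
        omega
    · refine ⟨i - 1, by omega, by rw [Nat.sub_add_cancel hi0], fun h => ?_⟩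
      rcases Nat.lt_or_ge (i + 1) p.length with hlt | hge
      · have := hinj (mem_Iio.2 (by omega)) (mem_Iio.2 (by omega)) h
        omega
      · rw [show i + 1 = p.length by omega, hcm] at h
        have := hinj (mem_Iio.2 (by omega)) (mem_Iio.2 (by omega)) h
        omega
  have h1 := hnb _ (hadj' i hi)
  have h2 := hnb _ (hki ▸ (hadj' k hk).symm)
  have h3 := hnb _ hxy
  have h4 : y = p.getVert (i + 1) ∨ y = p.getVert k := by
    rcases h1 with h1 | h1 <;> rcases h2 with h2 | h2 <;> rcases h3 with h3 | h3 <;> simp_all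
  rcases h4 with rfl | rfl
  · exact ⟨i, hi, Or.inl ⟨rfl, rfl⟩⟩
  · exact ⟨k, hk, Or.inr ⟨rfl, hki.symm⟩⟩

end PreAbstractSimplicialComplex

end

/-! ### Tetrahedra around an edge and connectedness of the dual graph -/

section

open Set Module

namespace PreAbstractSimplicialComplex

/-- A sphere of dimension at least two stays connected when countably many points are removed. -/
theorem isPreconnected_compl_sphere {n : ℕ} (hn : 2 ≤ n)
    {C : Set (Metric.sphere (0 : EuclideanSpace ℝ (Fin (n + 1))) 1)} (hC : C.Countable)
    (hne : C.Nonempty) : IsPreconnected Cᶜ := by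
  obtain ⟨p, hp⟩ := hne
  have : Fact (finrank ℝ (EuclideanSpace ℝ (Fin (n + 1))) = n + 1) :=
    ⟨finrank_euclideanSpace_fin⟩
  -- Projecting from a removed point reduces the claim to the complement of a countable set in a
  -- space of dimension at least two.
  let c := stereographic' n p
  have hsrc : c.source = {p}ᶜ := stereographic'_source p
  have htgt : c.target = univ := stereographic'_target p
  have hrank : 1 < Module.rank ℝ (EuclideanSpace ℝ (Fin n)) := by
    rw [← Module.finrank_eq_rank, finrank_euclideanSpace_fin]
    exact_mod_cast hn
  have h1 := (((hC.mono sdiff_subset).image c).isConnected_compl_of_one_lt_rank hrank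
    (s := c '' (C \ {p}))).isPreconnected
  have h2 := h1.image c.symm (c.symm.continuousOn.mono (by simp [htgt]))
  convert h2 using 1
  ext x
  constructor
  · intro hx
    have hxs : x ∈ c.source := by
      rw [hsrc]; rintro rfl; exact hx hp
    refine ⟨c x, ?_, c.left_inv hxs⟩
    rintro ⟨y, hy, hyx⟩
    have hys : y ∈ c.source := by rw [hsrc]; exact hy.2
    exact hx (c.injOn hys hxs hyx ▸ hy.1)
  · rintro ⟨z, hz, rfl⟩ hzC
    have hzt : z ∈ c.target := by simp [htgt]
    have hzs : c.symm z ∈ c.source := c.map_target hzt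
    rw [hsrc] at hzs
    exact hz ⟨c.symm z, ⟨hzC, hzs⟩, c.right_inv hzt⟩

variable {V : Type*} [DecidableEq V] {S : PreAbstractSimplicialComplex V}

theorem Tetrahedron.exists_eq_insert {t : Finset V} (ht : t.card = 3) {D : S.Tetrahedron}
    (htD : t ⊆ D.1) : ∃ x ∉ t, D.1 = insert x t := by
  obtain ⟨x, hx, h⟩ := Finset.exists_eq_insert_iff.2 ⟨htD, by rw [D.2.2, ht]⟩
  exact ⟨x, hx, h.symm⟩

variable [Fintype V]

theorem IsSphereTriangulation.eq_of_inter_eq (hS : S.IsSphereTriangulation 3) {t : Finset V}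
    (ht : t.card = 3) (htS : t ∈ S.faces) {D D₁ D₂ : S.Tetrahedron} (hD : t ⊆ D.1) (h₁ : t ⊆ D₁.1)
    (h₂ : t ⊆ D₂.1) (hne₁ : D ≠ D₁) (hne₂ : D ≠ D₂) : D₁ = D₂ := by
  obtain ⟨a, b, -, hab⟩ := hS.exists_two_facets (by norm_num) ht htS
  obtain ⟨x, hx, hDx⟩ := Tetrahedron.exists_eq_insert ht hD
  obtain ⟨x₁, hx₁, hDx₁⟩ := Tetrahedron.exists_eq_insert ht h₁
  obtain ⟨x₂, hx₂, hDx₂⟩ := Tetrahedron.exists_eq_insert ht h₂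
  have e := (hab x).1 ⟨hx, hDx ▸ D.2.1⟩
  have e₁ := (hab x₁).1 ⟨hx₁, hDx₁ ▸ D₁.2.1⟩
  have e₂ := (hab x₂).1 ⟨hx₂, hDx₂ ▸ D₂.2.1⟩
  have n₁ : x ≠ x₁ := fun h => hne₁ (Subtype.ext (by rw [hDx, hDx₁, h]))
  have n₂ : x ≠ x₂ := fun h => hne₂ (Subtype.ext (by rw [hDx, hDx₂, h]))
  have : x₁ = x₂ := by
    rcases e with rfl | rfl <;> rcases e₁ with rfl | rfl <;> rcases e₂ with rfl | rfl <;> simp_all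
  exact Subtype.ext (by rw [hDx₁, hDx₂, this])

/-- A neighbour is determined by the triangle it shares with `D`, and `D` has four triangles. -/
theorem IsSphereTriangulation.ncard_dualGraph_adj_le (hS : S.IsSphereTriangulation 3)
    (D : S.Tetrahedron) : {D' | S.dualGraph.Adj D D'}.ncard ≤ 4 := by
  have hcard : (D.1.powersetCard 3).card = 4 := by
    rw [Finset.card_powersetCard, D.2.2]; rfl
  rw [← hcard, ← Set.ncard_coe_finset]
  refine Set.ncard_le_ncard_of_injOn (fun D' => D.1 ∩ D'.1) ?_ ?_ (Set.toFinite _)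
  · intro D' h
    rw [Finset.mem_coe, Finset.mem_powersetCard]
    exact ⟨Finset.inter_subset_left, h.2⟩
  · intro D₁ h₁ D₂ h₂ h
    have hS' : D.1 ∩ D₁.1 ∈ S.faces := (S.isRelLowerSet_faces D.2.1).2 Finset.inter_subset_left
      (Finset.card_pos.1 (by rw [h₁.2]; norm_num))
    exact hS.eq_of_inter_eq h₁.2 hS' Finset.inter_subset_left Finset.inter_subset_right
      (by simp only at h; rw [h]; exact Finset.inter_subset_right) h₁.1 h₂.1

/-- The tetrahedra around an edge of a triangulated `3`-sphere form a chordless cycle of the dual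
graph. -/
theorem IsSphereTriangulation.exists_edge_cycle (hS : S.IsSphereTriangulation 3) {e : Finset V}
    (he : e ∈ S.faces) (he2 : e.card = 2) :
    ∃ (m : ℕ) (c : ℕ → V) (D : ℕ → S.Tetrahedron),
      InjOn D (Iic (m + 2)) ∧ (∀ i ≤ m + 2, c i ∉ e) ∧ (∀ i ≤ m + 2, e ⊆ (D i).1) ∧
      (∀ D' : S.Tetrahedron, e ⊆ D'.1 → ∃ i ≤ m + 2, D' = D i) ∧
      (∀ t ∈ S.faces, t.card = 3 → e ⊆ t → ∃ i ≤ m + 2, t = insert (c i) e) ∧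
      (∀ i < m + 2, S.dualGraph.Adj (D i) (D (i + 1)) ∧
        (D i).1 ∩ (D (i + 1)).1 = insert (c (i + 1)) e) ∧
      (S.dualGraph.Adj (D (m + 2)) (D 0) ∧ (D (m + 2)).1 ∩ (D 0).1 = insert (c 0) e) ∧
      ∀ i j, i < j → j ≤ m + 2 → S.dualGraph.Adj (D j) (D i) → j = i + 1 ∨ (i = 0 ∧ j = m + 2) := by
  obtain ⟨m', c, hm, hinj, hcm, hadj, hall⟩ := hS.exists_link_cycle (by omega)
    (Finset.card_pos.1 (by omega)) he
  obtain ⟨m, rfl⟩ : ∃ m, m' = m + 3 := ⟨m' - 3, by omega⟩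
  let DS : ℕ → Finset V := fun i => insert (c i) (insert (c (i + 1)) e)
  have hDS : ∀ i < m + 3, DS i ∈ S.faces ∧ (DS i).card = 4 := fun i hi => by
    obtain ⟨h1, h2, h3, h4⟩ := hadj i hi
    refine ⟨h4, ?_⟩
    rw [Finset.card_insert_of_notMem (by simp [h1, h2]), Finset.card_insert_of_notMem h3, he2]
  let D : ℕ → S.Tetrahedron := fun i => if h : i < m + 3 then ⟨DS i, hDS i h⟩ else
    ⟨DS 0, hDS 0 (by omega)⟩
  have hD : ∀ i ≤ m + 2, (D i).1 = DS i := fun i hi => by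
    simp only [D, dif_pos (show i < m + 3 by omega)]
  have hce : ∀ i ≤ m + 2, c i ∉ e := fun i hi => (hadj i (by omega)).2.1
  have hinj' : ∀ i ≤ m + 2, ∀ j ≤ m + 2, c i = c j → i = j := fun i hi j hj h =>
    hinj (mem_Iio.2 (by omega)) (mem_Iio.2 (by omega)) h
  have hmem : ∀ i ≤ m + 2, ∀ j ≤ m + 2, c j ∈ DS i → j = i ∨ j = i + 1 ∨ (i = m + 2 ∧ j = 0) := by
    intro i hi j hj h
    simp only [DS, Finset.mem_insert, hce j hj, or_false] at h
    rcases h with h | h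
    · exact Or.inl (hinj' j hj i hi h)
    · rcases Nat.lt_or_ge i (m + 2) with hlt | hge
      · exact Or.inr (Or.inl (hinj' j hj (i + 1) (by omega) h))
      · obtain rfl : i = m + 2 := by omega
        rw [hcm] at h
        exact Or.inr (Or.inr ⟨rfl, hinj' j hj 0 (by omega) h⟩)
  have hself : ∀ i, c i ∈ DS i := fun i => by simp [DS]
  have hDSe : ∀ i, e ⊆ DS i := fun i =>
    (Finset.subset_insert _ _).trans (Finset.subset_insert _ _)
  have hcons : ∀ i < m + 2, DS i ∩ DS (i + 1) = insert (c (i + 1)) e := by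
    intro i hi
    refine Finset.Subset.antisymm (fun x hx => ?_) (Finset.insert_subset (by simp [DS])
      (Finset.subset_inter (hDSe _) (hDSe _)))
    rw [Finset.mem_inter] at hx
    rcases Finset.mem_insert.1 hx.1 with rfl | h
    · have := hmem (i + 1) (by omega) i (by omega) hx.2
      omega
    · exact h
  have hclose : DS (m + 2) ∩ DS 0 = insert (c 0) e := by
    refine Finset.Subset.antisymm (fun x hx => ?_) (Finset.insert_subset (by simp [DS, hcm])
      (Finset.subset_inter (hDSe _) (hDSe _)))
    rw [Finset.mem_inter] at hx
    rcases Finset.mem_insert.1 hx.1 with rfl | h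
    · have := hmem 0 (by omega) (m + 2) (by omega) hx.2
      omega
    · rwa [hcm] at h
  have hcard3 : ∀ i ≤ m + 2, (insert (c i) e).card = 3 := fun i hi => by
    rw [Finset.card_insert_of_notMem (hce i hi), he2]
  refine ⟨m, c, D, ?_, hce, fun i hi => hD i hi ▸ hDSe i, ?_, ?_,
    ?_, ?_, ?_⟩
  · intro i hi j hj h
    have hi := mem_Iic.1 hi
    have hj := mem_Iic.1 hj
    have h' : DS i = DS j := by rw [← hD i hi, h, hD j hj]
    have h1 := hmem i hi j hj (h' ▸ hself j)
    have h2 := hmem j hj i hi (h' ▸ hself i)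
    omega
  · intro D' hD'
    have hcard : (D'.1 \ e).card = 2 := by
      rw [Finset.card_sdiff_of_subset hD', D'.2.2, he2]
    obtain ⟨v, w, hvw, hvw'⟩ := Finset.card_eq_two.1 hcard
    have hv : v ∈ D'.1 \ e := by simp [hvw']
    have hw : w ∈ D'.1 \ e := by simp [hvw']
    have hD'e : D'.1 = insert v (insert w e) := by
      rw [← Finset.sdiff_union_of_subset hD', hvw']
      ext; simp
    rw [Finset.mem_sdiff] at hv hw
    obtain ⟨i, hi, h⟩ := hall v w ⟨hvw, hv.2, hw.2, hD'e ▸ D'.2.1⟩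
    refine ⟨i, by omega, Subtype.ext ?_⟩
    rw [hD i (by omega), hD'e]
    rcases h with ⟨rfl, rfl⟩ | ⟨rfl, rfl⟩
    · rfl
    · exact Finset.insert_comm _ _ _
  · intro t ht ht3 het
    obtain ⟨x, hx, rfl⟩ := Finset.exists_eq_insert_iff.2 ⟨het, by omega⟩
    obtain ⟨i, hi, rfl⟩ := hS.mem_link_cycle (by omega) (Finset.card_pos.1 (by omega)) hm hinj hcm
      hadj hx ht
    exact ⟨i, by omega, rfl⟩
  · intro i hi
    have h1 : (D i).1 ∩ (D (i + 1)).1 = insert (c (i + 1)) e := by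
      rw [hD i (by omega), hD (i + 1) (by omega), hcons i hi]
    refine ⟨⟨fun h => ?_, ?_⟩, h1⟩
    · have h2 : DS i = DS (i + 1) := by rw [← hD i (by omega), h, hD (i + 1) (by omega)]
      have := hmem (i + 1) (by omega) i (by omega) (h2 ▸ hself i)
      omega
    · rw [h1, hcard3 _ (by omega)]
  · have h1 : (D (m + 2)).1 ∩ (D 0).1 = insert (c 0) e := by
      rw [hD (m + 2) le_rfl, hD 0 (by omega), hclose]
    refine ⟨⟨fun h => ?_, ?_⟩, h1⟩
    · have h2 : DS (m + 2) = DS 0 := by rw [← hD (m + 2) le_rfl, h, hD 0 (by omega)]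
      have := hmem 0 (by omega) (m + 2) (by omega) (h2 ▸ hself (m + 2))
      omega
    · rw [h1, hcard3 _ (by omega)]
  · rintro i j hij hj ⟨-, h⟩
    rw [hD i (by omega), hD j hj] at h
    -- Tetrahedra sharing a triangle share a vertex off `e`, that is, a vertex of the link cycle; so
    -- their sides of that cycle are adjacent.
    obtain ⟨x, hx, hxe⟩ := Finset.exists_mem_notMem_of_card_lt_card (show e.card < (DS j ∩ DS i).card
      by omega)
    rw [Finset.mem_inter] at hx
    simp only [DS, Finset.mem_insert, hxe, or_false] at hx
    have hx2 : x ∈ DS i := by simp only [DS, Finset.mem_insert, hxe, or_false]; exact hx.2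
    rcases hx.1 with rfl | rfl
    · have := hmem i (by omega) j hj hx2
      omega
    · rcases Nat.lt_or_ge j (m + 2) with hlt | hge
      · have := hmem i (by omega) (j + 1) (by omega) hx2
        omega
      · obtain rfl : j = m + 2 := by omega
        rw [hcm] at hx2
        have := hmem i (by omega) 0 (by omega) hx2
        omega

theorem IsSphereTriangulation.reachable_of_edge (hS : S.IsSphereTriangulation 3) {e : Finset V}
    (he2 : e.card = 2) {D₁ D₂ : S.Tetrahedron} (h₁ : e ⊆ D₁.1) (h₂ : e ⊆ D₂.1) :
    S.dualGraph.Reachable D₁ D₂ := by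
  have he : e ∈ S.faces := (S.isRelLowerSet_faces D₁.2.1).2 h₁ (Finset.card_pos.1 (by omega))
  obtain ⟨m, c, D, -, -, -, hall, -, hadj, -⟩ := hS.exists_edge_cycle he he2
  have hreach : ∀ i ≤ m + 2, S.dualGraph.Reachable (D 0) (D i) := by
    intro i
    induction i with
    | zero => exact fun _ => SimpleGraph.Reachable.refl _
    | succ i ih => exact fun hi => (ih (by omega)).trans (hadj i (by omega)).1.reachable
  obtain ⟨i, hi, rfl⟩ := hall D₁ h₁
  obtain ⟨j, hj, rfl⟩ := hall D₂ h₂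
  exact (hreach i hi).symm.trans (hreach j hj)

theorem exists_mem_realization_support {s : Finset V} (hs : s ∈ S.faces) :
    ∃ y ∈ S.realization, ∀ v, y v ≠ 0 ↔ v ∈ s := by
  have hcard : (0 : ℝ) < s.card := by
    exact_mod_cast Finset.card_pos.2 (S.isRelLowerSet_faces hs).1
  let y : V → ℝ := fun v => if v ∈ s then 1 / (s.card : ℝ) else 0
  have hy : ∀ v, y v ≠ 0 ↔ v ∈ s := fun v => by
    by_cases hv : v ∈ s <;> simp [y, hv, (S.isRelLowerSet_faces hs).1.ne_empty]
  refine ⟨y, ⟨⟨fun v => ?_, ?_⟩, s, hs, hy⟩, hy⟩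
  · simp only [y]; split_ifs <;> positivity
  · simp only [y, Finset.sum_ite_mem, Finset.univ_inter, Finset.sum_const, nsmul_eq_mul]
    field_simp

/-- The sphere minus the vertices of the triangulation is connected. So the tetrahedra reachable
from `D₀` and the others, two closed families covering it, meet at a point that is not a vertex.
Such a point forces a common edge, and tetrahedra around an edge are joined by its cycle. -/
theorem IsSphereTriangulation.connected_dualGraph (hS : S.IsSphereTriangulation 3)
    [Nonempty S.Tetrahedron] : S.dualGraph.Connected := by
  refine ⟨fun D₀ D₁ => ?_⟩
  by_contra hD₁
  let carrier : Set S.Tetrahedron → Set (V → ℝ) := fun A => ⋃ D ∈ A, {y | ∀ v ∉ D.1, y v = 0}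
  have hclosed : ∀ A, IsClosed (carrier A) := fun A => by
    refine (Set.toFinite A).isClosed_biUnion fun D _ => ?_
    simp only [Set.ofPred_forall]
    exact isClosed_iInter fun v => isClosed_iInter fun _ =>
      isClosed_eq (continuous_apply v) continuous_const
  let A : Set S.Tetrahedron := {D | S.dualGraph.Reachable D₀ D}
  let F : Set (V → ℝ) := range fun v => Pi.single v 1
  obtain ⟨v₀, hv₀⟩ : D₀.1.Nonempty := (S.isRelLowerSet_faces D₀.2.1).1
  have hv₀S : (Pi.single v₀ 1 : V → ℝ) ∈ S.realization :=
    mem_realization_of_subset (single_mem_stdSimplex ℝ v₀) D₀.2.1 fun v hv => by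
      by_contra h
      exact hv (Pi.single_eq_of_ne (fun h' : v = v₀ => h (by rw [h']; exact hv₀)) _)
  have hX : IsPreconnected (S.realization \ F) := by
    obtain ⟨h⟩ := hS.homeo
    have h1 : IsPreconnected (h '' (Subtype.val ⁻¹' F))ᶜ := by
      refine isPreconnected_compl_sphere (by norm_num) ?_ ?_
      · exact (((Set.finite_range _).preimage Subtype.val_injective.injOn).image h).countable
      · exact ⟨_, ⟨_, hv₀S⟩, ⟨v₀, rfl⟩, rfl⟩
    have h2 := (h1.image h.symm h.symm.continuous.continuousOn).image Subtype.val
      continuous_subtype_val.continuousOn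
    convert h2 using 1
    ext y
    constructor
    · rintro ⟨hy, hyF⟩
      refine ⟨⟨y, hy⟩, ⟨h ⟨y, hy⟩, ?_, by simp⟩, rfl⟩
      rintro ⟨z, hz, hzy⟩
      rw [h.injective hzy] at hz
      exact hyF hz
    · rintro ⟨_, ⟨z, hz, rfl⟩, rfl⟩
      exact ⟨Subtype.coe_prop _, fun hF => hz ⟨h.symm z, hF, by simp⟩⟩
  have hcover : S.realization \ F ⊆ carrier A ∪ carrier Aᶜ := by
    rintro y ⟨⟨-, s, hs, hys⟩, -⟩
    obtain ⟨D, hD, hDc, hsD⟩ := exists_facet_superset hS.pure hs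
    have hy : ∀ v ∉ D, y v = 0 := fun v hv => by
      by_contra h
      exact hv (hsD ((hys v).1 h))
    by_cases hA : (⟨D, hD, hDc⟩ : S.Tetrahedron) ∈ A
    · exact Or.inl (mem_biUnion hA hy)
    · exact Or.inr (mem_biUnion (show _ ∈ Aᶜ from hA) hy)
  have hnonempty : ∀ (B : Set S.Tetrahedron) (D : S.Tetrahedron), D ∈ B →
      ((S.realization \ F) ∩ carrier B).Nonempty := by
    intro B D hD
    obtain ⟨y, hy, hyD⟩ := exists_mem_realization_support D.2.1
    refine ⟨y, ⟨hy, ?_⟩, mem_biUnion hD fun v hv => by_contra fun h => hv ((hyD v).1 h)⟩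
    rintro ⟨v, rfl⟩
    have hsub : D.1 ⊆ {v} := fun w hw => by
      rw [Finset.mem_singleton]
      by_contra h
      exact (hyD w).2 hw (Pi.single_eq_of_ne h _)
    have := Finset.card_le_card hsub
    rw [D.2.2, Finset.card_singleton] at this
    omega
  obtain ⟨y, ⟨hyS, hyF⟩, hyA, hyA'⟩ := isPreconnected_closed_iff.1 hX _ _ (hclosed A) (hclosed Aᶜ)
    hcover (hnonempty A D₀ (SimpleGraph.Reachable.refl _)) (hnonempty Aᶜ D₁ hD₁)
  simp only [carrier, mem_iUnion, exists_prop] at hyA hyA'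
  obtain ⟨D, hD, hyD⟩ := hyA
  obtain ⟨D', hD', hyD'⟩ := hyA'
  obtain ⟨v, hv⟩ : ∃ v, y v ≠ 0 := by
    by_contra! h
    have := hyS.1.2
    simp [h] at this
  obtain ⟨w, hwv, hw⟩ : ∃ w ≠ v, y w ≠ 0 := by
    by_contra! h
    refine hyF ⟨v, ?_⟩
    have h1 := hyS.1.2
    rw [Finset.sum_eq_single v (fun w _ hw => h w hw) (by simp)] at h1
    funext w
    by_cases hwv : w = v
    · subst hwv; simp [h1]
    · simp [hwv, h w hwv]
  have hsub : ∀ T : S.Tetrahedron, (∀ v ∉ T.1, y v = 0) → ({v, w} : Finset V) ⊆ T.1 := by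
    intro T hT
    refine Finset.insert_subset ?_ (Finset.singleton_subset_iff.2 ?_)
    · by_contra h; exact hv (hT v h)
    · by_contra h; exact hw (hT w h)
  exact hD' (SimpleGraph.Reachable.trans hD (hS.reachable_of_edge (Finset.card_pair hwv.symm)
    (hsub D hyD) (hsub D' hyD')))

end PreAbstractSimplicialComplex

end

/-! ### Free edges and the final estimate -/

namespace PreAbstractSimplicialComplex

variable {V : Type*} [Fintype V] [DecidableEq V] {S : PreAbstractSimplicialComplex V}

/-- `X` and `Y` are the only tetrahedra containing `t`, so no other arc of `T` can remove it. -/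
theorem IsSphereTriangulation.mem_collapseAlong_iff (hS : S.IsSphereTriangulation 3)
    {T : SimpleGraph S.Tetrahedron} {t : Finset V} (ht : t ∈ S.faces) (ht3 : t.card = 3)
    {X Y : S.Tetrahedron} (hXY : X ≠ Y) (h : X.1 ∩ Y.1 = t) :
    t ∈ (S.collapseAlong T).faces ↔ ¬ T.Adj X Y := by
  have hX : t ⊆ X.1 := h ▸ Finset.inter_subset_left
  have hY : t ⊆ Y.1 := h ▸ Finset.inter_subset_right
  refine ⟨fun hc hT => hc.2.2 ⟨X, Y, hT, ht3, h.symm⟩, fun hT => ⟨ht, ht3.le, ?_⟩⟩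
  rintro ⟨D, D', hDD', -, hinter⟩
  have hD : t ⊆ D.1 := hinter ▸ Finset.inter_subset_left
  have hD' : t ⊆ D'.1 := hinter ▸ Finset.inter_subset_right
  by_cases hDX : D = X
  · subst hDX
    rw [hS.eq_of_inter_eq ht3 ht hD hD' hY hDD'.ne hXY] at hDD'
    exact hT hDD'
  · have h1 := hS.eq_of_inter_eq ht3 ht hD hD' hX hDD'.ne hDX
    have h2 := hS.eq_of_inter_eq ht3 ht hX hD hY (Ne.symm hDX) hXY
    rw [h1, h2] at hDD'
    exact hT hDD'.symm

end PreAbstractSimplicialComplex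

theorem theorem5p1 {V : Type*} [Fintype V] [DecidableEq V]
    (S : PreAbstractSimplicialComplex V) (hS : S.IsSphereTriangulation 3)
    (e : Finset V) (he : e ∈ S.faces) (he2 : e.card = 2)
    (k : ℕ) (hk : S.edgeDegree e = k) :
    (4 / 7 : ℝ) * (4 / 13 : ℝ) ^ ((k : ℤ) - 2) ≤ S.freeProportion e := by
  have : Fintype S.Tetrahedron := Fintype.ofFinite _
  obtain ⟨m, c, D, hD, hce, heD, hallD, hallt, hadj, hlast, hchord⟩ :=
    hS.exists_edge_cycle he he2
  have hkm : k = m + 3 := by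
    have h1 : {s : Finset V | s ∈ S.faces ∧ s.card = 4 ∧ e ⊆ s} =
        (fun i => (D i).1) '' Set.Iic (m + 2) := by
      ext s
      constructor
      · rintro ⟨hs, hs4, hes⟩
        obtain ⟨i, hi, h⟩ := hallD ⟨s, hs, hs4⟩ hes
        exact ⟨i, hi, congrArg Subtype.val h.symm⟩
      · rintro ⟨i, hi, rfl⟩
        exact ⟨(D i).2.1, (D i).2.2, heD i hi⟩
    rw [← hk, PreAbstractSimplicialComplex.edgeDegree, h1,
      Set.InjOn.ncard_image (fun i hi j hj h => hD hi hj (Subtype.ext h)), Set.ncard_eq_toFinset_card']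
    simp
  have : Nonempty S.Tetrahedron := ⟨D 0⟩
  have hmain := SimpleGraph.proportion_trees_chordless_cycle hS.connected_dualGraph
    hS.ncard_dualGraph_adj_le hD (fun i hi => (hadj i hi).1) hlast.1 hchord
  have hexp : (k : ℤ) - 2 = ((m + 1 : ℕ) : ℤ) := by rw [hkm]; push_cast; ring
  rw [hexp, zpow_natCast]
  refine hmain.trans ?_
  rw [PreAbstractSimplicialComplex.freeProportion]
  refine div_le_div_of_nonneg_right ?_ (Nat.cast_nonneg _)
  -- It suffices that each tree counted by the cycle estimate makes `e` free; trees missing an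
  -- earlier arc of the cycle are not needed.
  refine Nat.cast_le.2 (Set.ncard_le_ncard ?_ (Set.toFinite _))
  rintro T ⟨hT, hpath, hxor⟩
  have htri : ∀ i ≤ m + 2, insert (c i) e ∈ S.faces ∧ (insert (c i) e).card = 3 := by
    intro i hi
    refine ⟨?_, by rw [Finset.card_insert_of_notMem (hce i hi), he2]⟩
    rcases Nat.eq_zero_or_pos i with rfl | hi0
    · rw [← hlast.2]
      exact (S.isRelLowerSet_faces (D 0).2.1).2 Finset.inter_subset_right
        (hlast.2 ▸ Finset.insert_nonempty _ _)
    · obtain ⟨j, rfl⟩ : ∃ j, i = j + 1 := ⟨i - 1, by omega⟩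
      rw [← (hadj j (by omega)).2]
      exact (S.isRelLowerSet_faces (D j).2.1).2 Finset.inter_subset_left
        ((hadj j (by omega)).2 ▸ Finset.insert_nonempty _ _)
  have hsucc : ∀ i < m + 2, insert (c (i + 1)) e ∈ (S.collapseAlong T).faces ↔
      ¬ T.Adj (D i) (D (i + 1)) := fun i hi =>
    hS.mem_collapseAlong_iff (htri _ (by omega)).1 (htri _ (by omega)).2 (hadj i hi).1.ne
      (hadj i hi).2
  have hzero : insert (c 0) e ∈ (S.collapseAlong T).faces ↔ ¬ T.Adj (D 0) (D (m + 2)) := by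
    rw [T.adj_comm]
    exact hS.mem_collapseAlong_iff (htri 0 (by omega)).1 (htri 0 (by omega)).2 hlast.1.ne hlast.2
  refine ⟨hT, ⟨he, by omega, fun ⟨_, _, _, h3, _⟩ => by omega⟩, he2, ?_⟩
  have hunique : ∀ a ≤ m + 2, insert (c a) e ∈ (S.collapseAlong T).faces →
      (∀ i ≤ m + 2, insert (c i) e ∈ (S.collapseAlong T).faces → i = a) →
      {t : Finset V | t ∈ (S.collapseAlong T).faces ∧ t.card = 3 ∧ e ⊆ t}.ncard = 1 := by
    intro a ha hmem huniq
    rw [Set.ncard_eq_one]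
    refine ⟨insert (c a) e, Set.eq_singleton_iff_unique_mem.2
      ⟨⟨hmem, (htri a ha).2, Finset.subset_insert _ _⟩, ?_⟩⟩
    rintro t ⟨ht, ht3, het⟩
    obtain ⟨i, hi, rfl⟩ := hallt t ht.1 ht3 het
    rw [huniq i hi ht]
  have hinner : ∀ i, 0 < i → i ≤ m + 1 → insert (c i) e ∉ (S.collapseAlong T).faces := by
    intro i hi0 hi h
    obtain ⟨j, rfl⟩ : ∃ j, i = j + 1 := ⟨i - 1, by omega⟩
    exact (hsucc j (by omega)).1 h (hpath j (by omega))
  -- The surviving triangle belongs to the missing arc: vertex `c 0` for the closing arc, vertex `c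
  -- (m + 2)` for the one before it.
  rcases hxor with ⟨h1, h2⟩ | ⟨h1, h2⟩
  · refine hunique 0 (by omega) (hzero.2 h2) fun i hi h => ?_
    by_contra hi0
    rcases Nat.lt_or_ge i (m + 2) with hlt | hge
    · exact hinner i (by omega) (by omega) h
    · obtain rfl : i = m + 1 + 1 := by omega
      exact (hsucc (m + 1) (by omega)).1 h h1
  · refine hunique (m + 2) le_rfl ((hsucc (m + 1) (by omega)).2 h2) fun i hi h => ?_
    by_contra hi'
    rcases Nat.eq_zero_or_pos i with rfl | hi0
    · exact hzero.1 h h1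
    · exact hinner i hi0 (by omega) h
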